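/- **Setting.** Let $\mathbb{K}$ be a field of characteristic $0$. "Complete Lie algebra" means a Lie algebra $L$ over $\mathbb{K}$ that is complete with respect to its lower central series $L^1=L$, $L^{n+1}=[L^n,L]$ (that is, $L\to\varprojlim L/L^n$ is bijective); sums in $L$ are taken in the corresponding topology. Let $b_n\in\mathbb{Q}$ be defined by $\sum_{n\ge 0}b_nx^n=\frac{x}{e^x-1}$, and let $x\bullet y=\log(e^xe^y)$ be the Baker–Campbell–Hausdorff product on $L$, i.e. the sum of the values at $(x,y)$ of the Lie polynomials which are the homogeneous components of $\log(e^Xe^Y)$. For a planar binary rooted tree $\Gamma$, write $u\to v$ if the vertex $v$ lies on the path from the vertex $u$ to the root. A rightmost branch is a maximal connected subgraph all of whose edges are rightmost edges; a subroot is the vertex nearest to the root of a rightmost branch having at least two vertices; $R(\Gamma)$ is the set of subroots. For an internal vertex $v$, $m(v)$ is the leaf on the rightmost branch containing $v$, and $d(v)$ is the distance between $v$ and $m(v)$. Let $\mathcal{B}(b\le a)$ be the set of pairs $(\Gamma,f)$ with $\Gamma$ as above and $f$ a labelling of the leaves by the two elements of the poset $\{b\le a\}$ such that $f(u)\le f(m(v))$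 for every subroot $v$ and every leaf $u\to v$. Let $t(v)$ be the number of leaves $u\to v$ with $f(u)=f(m(v))$. Given any sequence $(a_n)_{n>0}$ in $\mathbb{K}$, put $a_{(\Gamma,f)}=\prod_{v\in R(\Gamma)}\frac{a_{d(v)}}{t(v)}$ and, for $x,y$ in a complete Lie algebra, $$x\ast y=\sum_{(\Gamma,f)\in\mathcal{B}(b\le a)}a_{(\Gamma,f)}\,Z_\Gamma(f),$$ where $Z_\Gamma(f)$ is the iterated bracket prescribed by $\Gamma$, with $x$ at the leaves labelled $a$ and $y$ at the leaves labelled $b$. "$\ast$ is associative" means $(x\ast y)\ast z=x\ast(y\ast z)$ for all $x,y,z$ in every complete Lie algebra over $\mathbb{K}$. **Proposition.** The series defining $x\ast y$ converges for all $x,y$ in every complete Lie algebra. Moreover: 1. The product $\ast$ is associative if and only if there exists $h\in\mathbb{K}$ such that $a_n=h^nb_n$ for every $n>0$. 2. If $a_n=h^nb_n$ for every $n>0$ with $h\neq 0$, then $x\ast y=h^{-1}\big((hx)\bullet(hy)\big)$ for all $x,y$ in every complete Lie algebra. 3. If $\ast$ is associative, then $(1+n(-1)^n)\,a_n=-\sum_{i=1}^{n-1}(-1)^ia_ia_{n-i}$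 for every $n>0$. -/

import Mathlib

universe u v

/-- Planar binary rooted trees whose leaves carry labels in `A`, that is, the pairs `(Γ, f)` with
`Γ` a planar binary rooted tree and `f : L(Γ) → A`. `node l r` is a root with left subtree `l`
and right subtree `r`. -/
inductive LTree (A : Type) : Type
  | leaf : A → LTree A
  | node : LTree A → LTree A → LTree A

namespace LTree

variable {A : Type}

/-- The labels of the leaves, from left to right. -/
def leaves : LTree A → List A
  | leaf x => [x]
  | node l r => leaves l ++ leaves r

/-- The label of `m(v)`, where `v` is the root: the last vertex of the rightmost branch that
starts at the root. -/
def mLabel : LTree A → A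
  | leaf x => x
  | node _ r => mLabel r

/-- `d(v)` for the root `v`: the number of edges between `v` and `m(v)`. -/
def d : LTree A → ℕ
  | leaf _ => 0
  | node _ r => d r + 1

/-- `t(v)` for the root `v`: the number of leaves `u → v` with `f(u) = f(m(v))`. -/
def t [DecidableEq A] (T : LTree A) : ℕ := T.leaves.count T.mLabel

/-- The tree itself if its root is an internal vertex, and nothing otherwise. -/
def rootIfInternal : LTree A → List (LTree A)
  | leaf _ => []
  | node l r => [node l r]

/-- The subroots other than the root. A vertex `v` different from the root is a subroot if and only
if it is internal and the edge from `v` to its parent is not a rightmost edge, which means in a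
binary tree that `v` is a left child. A vertex is represented by the subtree of all vertices below
it (repetitions occur when different vertices have equal subtrees). -/
def properSubroots : LTree A → List (LTree A)
  | leaf _ => []
  | node l r => rootIfInternal l ++ properSubroots l ++ properSubroots r

/-- The subroots: the vertices nearest to the root of the non trivial rightmost branches, each
represented by the subtree below it. -/
def subroots (T : LTree A) : List (LTree A) := T.rootIfInternal ++ T.properSubroots

/-- The labelling is monotone for the order `⪯` on leaves, where `l₁ ⪯ l₂` means that `l₁ = l₂`, or
`l₂ = m(v)` and `l₁ → v` for some subroot `v`. -/
def IsPosetted [LE A] (T : LTree A) : Prop :=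
  ∀ v ∈ T.subroots, ∀ x ∈ v.leaves, x ≤ v.mLabel

/-- The product `Z_Γ(f)` with respect to the Lie bracket, the leaves with label `c` being given the
value `φ c`. -/
def Z {L : Type*} [Bracket L L] (φ : A → L) : LTree A → L
  | leaf c => φ c
  | node l r => ⁅Z φ l, Z φ r⁆

/-- The coefficient `a_(Γ,f)`: the product of `a_{d(v)} / t(v)` over the subroots `v`. -/
def coeff [DecidableEq A] {K : Type*} [Field K] (a : ℕ → K) (T : LTree A) : K :=
  (T.subroots.map fun v => a v.d / (v.t : K)).prod

end LTree

/-- The set `𝓑(b ≤ a)` of posetted binary trees; the labels `b`, `a` of the poset `{b ≤ a}` are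
`false`, `true`. -/
def BTrees : Type := {T : LTree Bool // T.IsPosetted}

/-- The values of the two labels: `a = true` has the value `x` and `b = false` the value `y`. -/
def labelValues {M : Type*} (x y : M) (c : Bool) : M := bif c then x else y

section Complete

variable (K : Type*) [Field K] {L : Type*} [LieRing L] [LieAlgebra K L]

variable (L) in
/-- `L` is complete with respect to its lower central series (`lowerCentralSeries K L L n` is
`L^(n+1)`): the map from `L` to the inverse limit of the `L / L^n` is injective and surjective. -/
structure LCSComplete : Prop where
  separated : ∀ x : L, (∀ n, x ∈ LieModule.lowerCentralSeries K L L n) → x = 0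
  complete : ∀ u : ℕ → L, (∀ n, u (n + 1) - u n ∈ LieModule.lowerCentralSeries K L L n) →
    ∃ x : L, ∀ n, u n - x ∈ LieModule.lowerCentralSeries K L L n

/-- The family `f` has the (unordered) sum `s` in the topology of the lower central series. -/
def LCSHasSum {ι : Type*} (f : ι → L) (s : L) : Prop :=
  ∀ n, ∃ S : Finset ι, ∀ T : Finset ι, S ⊆ T →
    (∑ i ∈ T, f i) - s ∈ LieModule.lowerCentralSeries K L L n

/-- The sum of a family in the topology of the lower central series. -/
noncomputable def lcsSum {ι : Type*} (f : ι → L) : L := Classical.epsilon (LCSHasSum K f)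

variable {K}

/-- The family whose sum is `x ∗ y`: the terms `a_(Γ,f) Z_Γ(f)`, for `(Γ, f)` in `𝓑(b ≤ a)`. -/
def starTerm (a : ℕ → K) (x y : L) (T : BTrees) : L := T.1.coeff a • T.1.Z (labelValues x y)

/-- The product `x ∗ y`. -/
noncomputable def starProd (a : ℕ → K) (x y : L) : L := lcsSum K (starTerm a x y)

end Complete

/-- The coefficients `b_n` of `x / (e^x - 1)`: the Bernoulli number `B_n` (with `B_1 = -1/2`)
divided by `n!`. -/
noncomputable def bernCoeff (K : Type*) [Field K] (n : ℕ) : K :=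
  ((bernoulli n / (n.factorial : ℚ) : ℚ) : K)

section BCH

variable (K : Type*) [Field K]

/-- The formal series `e^(Xs)`, with `X` a free generator and `s` the grading variable. -/
noncomputable def genExp (c : Bool) : PowerSeries (FreeAlgebra K Bool) :=
  PowerSeries.mk fun n => ((n.factorial : K)⁻¹) • FreeAlgebra.ι K c ^ n

/-- The component of degree `n` of `log(e^X e^Y)` in the free associative algebra on `X = true` and
`Y = false`: the coefficient of `s^n` in `∑_{k ≥ 1} (-1)^(k-1) (e^(Xs) e^(Ys) - 1)^k / k`, to which
only the `k ≤ n` contribute. -/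
noncomputable def logTerm (n : ℕ) : FreeAlgebra K Bool :=
  ∑ k ∈ Finset.Icc 1 n, ((-1 : K) ^ (k - 1) / (k : K)) •
    PowerSeries.coeff n ((genExp K true * genExp K false - 1) ^ k)

attribute [local instance] LieRing.ofAssociativeRing in
/-- The elements `w n` of the free Lie algebra on two generators are the homogeneous components of
`log(e^X e^Y)`. -/
def IsBCHSeries (w : ℕ → FreeLieAlgebra K Bool) : Prop :=
  ∀ n, FreeLieAlgebra.lift K (FreeAlgebra.ι K : Bool → FreeAlgebra K Bool) (w n) = logTerm K n

/-- `p` is the Baker-Campbell-Hausdorff product `x • y = log(e^x e^y)` in `L`: the sum of the values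
at `(x, y)` of the Lie polynomials that are the homogeneous components of `log(e^X e^Y)`. -/
def IsBCHProduct {L : Type*} [LieRing L] [LieAlgebra K L] (x y p : L) : Prop :=
  ∃ w : ℕ → FreeLieAlgebra K Bool, IsBCHSeries K w ∧
    LCSHasSum K (fun n => FreeLieAlgebra.lift K (labelValues x y) (w n)) p

end BCH

/-- The product `∗` defined by the sequence `a` is associative (in every Lie algebra over `K` that
is complete with respect to its lower central series). -/
def StarAssociative {K : Type u} [Field K] (a : ℕ → K) : Prop :=
  ∀ (L : Type (max u v)) [LieRing L] [LieAlgebra K L], LCSComplete K L →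
    ∀ x y z : L, starProd a (starProd a x y) z = starProd a x (starProd a y z)

open Finset.HasAntidiagonal (antidiagonal mem_antidiagonal)

/-! The product is governed by a differential equation. Let `P = x ∗ y` and let `D` be a derivation
with `D x = x` and `D y = 0`. It multiplies the term of a tree by the number of its leaves labelled
`true`. If the rightmost leaf is labelled `true`, this number cancels the denominator `t` at the
root; otherwise a posetted tree has no such leaf and its term dies. Cutting along the rightmost
branch leaves independent posetted trees attached on its left, so `D P = ∑ a_k (ad P)^k x` with `a_0
= 1` (`deriv_starTrunc_sub_mem`).

For `a_n = b_n` the series on the right is inverse to the factor `(e^t - 1)/t`, `t = ad P`, in the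
derivative of the exponential, whence `D (e^P) = x e^P`. Once `x` carries a grading variable, this
equation determines `e^P` from its value at `x = 0`, and `e^P = e^x e^y` in nilpotent associative
algebras (`truncExp_starTrunc`). Taking logarithms gives associativity and the comparison with
Baker-Campbell-Hausdorff. Associativity descends to the free Lie algebra because that embeds into
the free associative algebra (`mem_lowerCentralSeries_of_freeGraded`), and then holds in every
complete Lie algebra by substitution. Scaling `x` and `y` by `h ≠ 0` turns `b_n` into `h^n b_n`; for
`h = 0` the product is addition.

Conversely, the differential equation computes both bracketings of a triple product in a small
metabelian Lie algebra `TestLie`. Equating them gives a quadratic recursion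
(`riccati_of_starAssociative`) that determines every `a_n` from `a_1`. The numbers `h^n b_n` with `h
= -2 a_1` satisfy the same recursion, because `f = X/(e^X - 1)` solves a Riccati equation. The third
claim is then an identity between the `b_n`, obtained from that equation and `f(-X) = f + X`.

All computations are made with finite truncations modulo the `N`-th step of a filtration. -/

namespace LTree

variable {A : Type}

/-! ### Leaf counts and finiteness of the trees of bounded size. -/

theorem leaves_length_pos (T : LTree A) : 0 < T.leaves.length := by
  induction T with
  | leaf x => simp [leaves]
  | node l r ihl ihr => simp only [leaves, List.length_append]; omega

theorem d_lt_leaves_length (T : LTree A) : T.d < T.leaves.length := by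
  induction T with
  | leaf x => simp [leaves, d]
  | node l r ihl ihr =>
    have := l.leaves_length_pos
    simp only [leaves, List.length_append, d]; omega

theorem mLabel_mem_leaves (T : LTree A) : T.mLabel ∈ T.leaves := by
  induction T with
  | leaf x => simp [leaves, mLabel]
  | node l r ihl ihr => simp [leaves, mLabel, ihr]

theorem finite_leaves_length_lt [Finite A] (N : ℕ) :
    {T : LTree A | T.leaves.length < N}.Finite := by
  induction N with
  | zero => simp
  | succ N ih =>
    refine ((Set.finite_range (leaf : A → LTree A)).union (ih.image2 node ih)).subset ?_
    rintro (c | ⟨l, r⟩) hT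
    · exact Or.inl ⟨c, rfl⟩
    · have hl := l.leaves_length_pos
      have hr := r.leaves_length_pos
      simp only [leaves, List.length_append, Set.mem_ofPred_eq] at hT
      exact Or.inr ⟨l, by simp only [Set.mem_ofPred_eq]; omega,
        r, by simp only [Set.mem_ofPred_eq]; omega, rfl⟩

/-- The trees with fewer than `N` leaves. -/
noncomputable def smallTrees (A : Type) [Finite A] (N : ℕ) : Finset (LTree A) :=
  (finite_leaves_length_lt (A := A) N).toFinset

@[simp]
theorem mem_smallTrees [Finite A] {N : ℕ} {T : LTree A} : T ∈ smallTrees A N ↔ T.leaves.length < N := by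
  simp [smallTrees]

/-! ### Coefficients -/

section Coeff

variable {K : Type*} [Field K]

open Classical in
/-- The coefficient of a tree, extended by zero to the trees that are not posetted. -/
noncomputable def wcoeff (a : ℕ → K) (T : LTree Bool) : K :=
  if T.IsPosetted then T.coeff a else 0

/-- The condition of a posetted tree at the subroots other than the root. -/
def SpinePosetted (T : LTree Bool) : Prop :=
  ∀ v ∈ T.properSubroots, ∀ x ∈ v.leaves, x ≤ v.mLabel

open Classical in
/-- The part of the coefficient of a tree that comes from the subroots other than the root. -/
noncomputable def spineCoeff (a : ℕ → K) (T : LTree Bool) : K :=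
  if T.SpinePosetted then
    (T.properSubroots.map fun v => a v.d / (v.t : K)).prod else 0

@[simp]
theorem wcoeff_leaf (a : ℕ → K) (c : Bool) : (leaf c).wcoeff a = 1 := by
  simp [wcoeff, IsPosetted, coeff, subroots, rootIfInternal, properSubroots]

@[simp]
theorem spineCoeff_leaf (a : ℕ → K) (c : Bool) : (leaf c).spineCoeff a = 1 := by
  simp [spineCoeff, SpinePosetted, properSubroots]

/-- The root of `r` continues the rightmost branch of the whole tree and is no subroot of it,
whereas the root of `l`, if internal, starts a branch of its own. This asymmetry makes the sums over
trees factor along the rightmost branch. -/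
theorem spineCoeff_node (a : ℕ → K) (l r : LTree Bool) :
    (node l r).spineCoeff a = l.wcoeff a * r.spineCoeff a := by
  have h : (node l r).properSubroots = l.subroots ++ r.properSubroots := rfl
  have hiff : (node l r).SpinePosetted ↔ l.IsPosetted ∧ r.SpinePosetted := by
    simp only [SpinePosetted, IsPosetted, h, List.forall_mem_append]
  by_cases hl : l.IsPosetted <;> by_cases hr : r.SpinePosetted <;>
    simp [spineCoeff, wcoeff, coeff, hiff, h, hl, hr]

theorem wcoeff_node_of_mLabel (a : ℕ → K) {l r : LTree Bool} (h : r.mLabel = true) :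
    (node l r).wcoeff a =
      a (node l r).d / ((node l r).t : K) * (node l r).spineCoeff a := by
  have hs : (node l r).subroots = node l r :: (node l r).properSubroots := rfl
  have hm : (node l r).mLabel = true := h
  have hle : ∀ x : Bool, x ≤ true := fun x => Bool.le_true x
  have hiff : (node l r).IsPosetted ↔ (node l r).SpinePosetted := by
    simp only [SpinePosetted, IsPosetted, hs, List.forall_mem_cons, hm, hle, implies_true,
      true_and]
  by_cases hP : (node l r).SpinePosetted <;> simp [wcoeff, spineCoeff, coeff, hiff, hP, hs]

theorem count_true_eq_zero (a : ℕ → K) {T : LTree Bool} (h : T.mLabel = false)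
    (hT : T.wcoeff a ≠ 0) : T.leaves.count true = 0 := by
  cases T with
  | leaf c => simp_all [leaves, mLabel]
  | node l r =>
    have hP : (node l r).IsPosetted := by
      by_contra hc; exact hT (by simp [wcoeff, hc])
    have := hP (node l r) (by simp [subroots, rootIfInternal])
    rw [List.count_eq_zero]
    intro hmem
    have h2 := this _ hmem
    rw [h] at h2
    exact absurd h2 (by decide)

/-- The sequence `a` with the value `1` in degree zero. -/
def withOne (a : ℕ → K) (n : ℕ) : K := if n = 0 then 1 else a n

/-- With rightmost label `true` the count is exactly `t` of the root and cancels the denominator;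
with rightmost label `false` monotonicity excludes the label `true` altogether. The value `1` in
degree zero accounts for the single leaf. -/
theorem count_mul_wcoeff [CharZero K] (a : ℕ → K) (T : LTree Bool) :
    (T.leaves.count true : K) * T.wcoeff a =
      if T.mLabel = true then withOne a T.d * T.spineCoeff a else 0 := by
  by_cases h : T.mLabel = true
  · rw [if_pos h]
    cases T with
    | leaf c =>
      have : c = true := h
      subst this
      simp [leaves, d, withOne]
    | node l r =>
      have ht : (node l r).leaves.count true = (node l r).t := by rw [t, h]
      have hr : r.mLabel = true := h
      have hpos : ((node l r).t : K) ≠ 0 := by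
        rw [Nat.cast_ne_zero, t]
        exact (List.count_pos_iff.mpr (mLabel_mem_leaves _)).ne'
      rw [wcoeff_node_of_mLabel a hr, ht, ← mul_assoc, mul_div_cancel₀ _ hpos]
      simp [withOne, d]
  · rw [if_neg h]
    by_cases hT : T.wcoeff a = 0
    · simp [hT]
    · simp [count_true_eq_zero a (by simpa using h) hT]

/-- Every internal vertex lies on exactly one rightmost branch, so the `d(v)` of all subroots add up
to the number of leaves minus one; leaving out the root branch lowers this by `T.d`. The extra
powers of `h` on the left avoid subtraction in the exponents. -/
theorem wcoeff_mul_pow (a : ℕ → K) (h : K) (T : LTree Bool) :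
    T.spineCoeff (fun n => h ^ n * a n) * h ^ (T.d + 1) =
        h ^ T.leaves.length * T.spineCoeff a ∧
      T.wcoeff (fun n => h ^ n * a n) * h = h ^ T.leaves.length * T.wcoeff a := by
  induction T with
  | leaf c => simp [leaves, d]
  | node l r ihl ihr =>
    have h1 : (node l r).spineCoeff (fun n => h ^ n * a n) * h ^ ((node l r).d + 1) =
        h ^ (node l r).leaves.length * (node l r).spineCoeff a := by
      simp only [spineCoeff_node, d, leaves, List.length_append]
      calc _ = (l.wcoeff (fun n => h ^ n * a n) * h) *
            (r.spineCoeff (fun n => h ^ n * a n) * h ^ (r.d + 1)) := by ring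
        _ = _ := by rw [ihl.2, ihr.1]; ring
    refine ⟨h1, ?_⟩
    have hs : (node l r).subroots = node l r :: (node l r).properSubroots := rfl
    have key : ∀ b : ℕ → K, (node l r).wcoeff b = (if ∀ x ∈ (node l r).leaves,
        x ≤ (node l r).mLabel then b (node l r).d / ((node l r).t : K) else 0) *
        (node l r).spineCoeff b := by
      intro b
      have hiff : (node l r).IsPosetted ↔ (∀ x ∈ (node l r).leaves, x ≤ (node l r).mLabel) ∧
          (node l r).SpinePosetted := by
        simp only [SpinePosetted, IsPosetted, hs, List.forall_mem_cons]
      by_cases hQ : ∀ x ∈ (node l r).leaves, x ≤ (node l r).mLabel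
      · rw [if_pos hQ]
        rw [and_iff_right hQ] at hiff
        by_cases hP : (node l r).SpinePosetted <;>
          simp [wcoeff, spineCoeff, coeff, hiff, hP, hs]
      · rw [if_neg hQ, zero_mul, wcoeff, if_neg fun h => hQ (hiff.mp h).1]
    rw [key, key]
    split_ifs
    · calc _ = a (node l r).d / ((node l r).t : K) * ((node l r).spineCoeff
            (fun n => h ^ n * a n) * h ^ ((node l r).d + 1)) := by ring
        _ = _ := by rw [h1]; ring
    · simp

end Coeff

/-! ### Iterated brackets -/

section Bracket

variable {L : Type*} [LieRing L]

theorem Z_map {M : Type*} [LieRing M] {F : Type*} [FunLike F L M] (f : F)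
    (hf : ∀ u v : L, f ⁅u, v⁆ = ⁅f u, f v⁆) (φ : A → L) (T : LTree A) :
    f (T.Z φ) = T.Z (fun c => f (φ c)) := by
  induction T with
  | leaf c => rfl
  | node l r ihl ihr => simp only [Z, hf, ihl, ihr]

/-- The second conjunct is the induction hypothesis: a subtree contributes either zero or a label
value, and such elements commute. -/
theorem Z_eq_zero_or (φ : A → L) (hφ : ∀ c c', ⁅φ c, φ c'⁆ = 0) (T : LTree A) :
    (∀ l r, T = node l r → T.Z φ = 0) ∧ (T.Z φ = 0 ∨ ∃ c, T.Z φ = φ c) := by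
  induction T with
  | leaf c => exact ⟨by simp, Or.inr ⟨c, rfl⟩⟩
  | node l r ihl ihr =>
    have : (node l r).Z φ = 0 := by
      simp only [Z]
      rcases ihl.2 with h | ⟨c, h⟩ <;> rcases ihr.2 with h' | ⟨c', h'⟩ <;> simp [h, h', hφ]
    exact ⟨fun _ _ _ => this, Or.inl this⟩

theorem Z_node_eq_zero (φ : A → L) (hφ : ∀ c c', ⁅φ c, φ c'⁆ = 0) (l r : LTree A) :
    (node l r).Z φ = 0 :=
  (Z_eq_zero_or φ hφ _).1 l r rfl

theorem Z_sub_mem (S : AddSubgroup L) (hS : ∀ u : L, ∀ v ∈ S, ⁅u, v⁆ ∈ S) {φ ψ : A → L}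
    (h : ∀ c, φ c - ψ c ∈ S) (T : LTree A) : T.Z φ - T.Z ψ ∈ S := by
  induction T with
  | leaf c => exact h c
  | node l r ihl ihr =>
    have : (node l r).Z φ - (node l r).Z ψ =
        ⁅l.Z φ, r.Z φ - r.Z ψ⁆ - ⁅r.Z ψ, l.Z φ - l.Z ψ⁆ := by
      simp only [Z, lie_sub]
      rw [← lie_skew (r.Z ψ) (l.Z φ), ← lie_skew (r.Z ψ) (l.Z ψ)]; abel
    rw [this]
    exact S.sub_mem (hS _ _ ihr) (hS _ _ ihl)

variable {K : Type*} [Field K] [LieAlgebra K L]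

theorem Z_smul (φ : A → L) (h : K) (T : LTree A) :
    T.Z (fun c => h • φ c) = h ^ T.leaves.length • T.Z φ := by
  induction T with
  | leaf c => simp [Z, leaves]
  | node l r ihl ihr =>
    simp only [Z, ihl, ihr, leaves, List.length_append, smul_lie, lie_smul, smul_smul, pow_add,
      mul_comm]

end Bracket

end LTree

/-- A decreasing filtration of a Lie algebra that is compatible with the bracket. -/
structure LieFiltration (K L : Type*) [Field K] [LieRing L] [LieAlgebra K L] where
  toFun : ℕ → Submodule K L
  anti : Antitone toFun
  lie_mem : ∀ {m n : ℕ} {x y : L}, x ∈ toFun m → y ∈ toFun n → ⁅x, y⁆ ∈ toFun (m + n)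

/-! ### Truncated products in a filtered Lie algebra. -/

section Trunc

variable {K : Type*} [Field K] {L : Type*} [LieRing L] [LieAlgebra K L]

theorem LTree.Z_mem {A : Type} (I : LieFiltration K L) {φ : A → L} (h : ∀ c, φ c ∈ I.toFun 1)
    (T : LTree A) : T.Z φ ∈ I.toFun T.leaves.length := by
  induction T with
  | leaf c => exact h c
  | node l r ihl ihr => simpa [LTree.leaves, LTree.Z] using I.lie_mem ihl ihr

theorem labelValues_mem {S : Submodule K L} {x y : L} (hx : x ∈ S) (hy : y ∈ S) (c : Bool) :
    labelValues x y c ∈ S := by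
  cases c <;> simpa [labelValues]

/-- The sum of the terms of `x ∗ y` with fewer than `N` leaves. -/
noncomputable def starTrunc (a : ℕ → K) (N : ℕ) (x y : L) : L :=
  ∑ T ∈ LTree.smallTrees Bool N, T.wcoeff a • T.Z (labelValues x y)

theorem starTrunc_map {M : Type*} [LieRing M] [LieAlgebra K M] (f : L →ₗ⁅K⁆ M) (a : ℕ → K) (N : ℕ)
    (x y : L) : f (starTrunc a N x y) = starTrunc a N (f x) (f y) := by
  simp only [starTrunc, map_sum, map_smul]
  refine Finset.sum_congr rfl fun T _ => ?_
  rw [LTree.Z_map f (LieHom.map_lie f)]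
  congr 2
  ext c
  cases c <;> rfl

theorem starTrunc_mem (I : LieFiltration K L) (a : ℕ → K) (N : ℕ) {x y : L}
    (hx : x ∈ I.toFun 1) (hy : y ∈ I.toFun 1) : starTrunc a N x y ∈ I.toFun 1 :=
  Submodule.sum_mem _ fun T _ => Submodule.smul_mem _ _
    (I.anti T.leaves_length_pos (T.Z_mem I (labelValues_mem hx hy)))

theorem starTrunc_sub_mem (S : Submodule K L) (hS : ∀ u : L, ∀ v ∈ S, ⁅u, v⁆ ∈ S) (a : ℕ → K) (N : ℕ)
    {x y x' y' : L} (hx : x - x' ∈ S) (hy : y - y' ∈ S) :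
    starTrunc a N x y - starTrunc a N x' y' ∈ S := by
  simp only [starTrunc, ← Finset.sum_sub_distrib, ← smul_sub]
  refine Submodule.sum_mem _ fun T _ => Submodule.smul_mem _ _ ?_
  exact LTree.Z_sub_mem S.toAddSubgroup hS (fun c => by cases c <;> simpa [labelValues]) T

theorem smul_starTrunc (a : ℕ → K) (h : K) (N : ℕ) (x y : L) :
    h • starTrunc (fun n => h ^ n * a n) N x y = starTrunc a N (h • x) (h • y) := by
  simp only [starTrunc, Finset.smul_sum]
  refine Finset.sum_congr rfl fun T _ => ?_
  have : labelValues (h • x) (h • y) = fun c => h • labelValues x y c := by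
    ext c; cases c <;> rfl
  rw [this, LTree.Z_smul, smul_smul, smul_smul, mul_comm h, (T.wcoeff_mul_pow a h).2, mul_comm]

theorem starTrunc_of_node_eq_zero (a : ℕ → K) {N : ℕ} (hN : 2 ≤ N) (x y : L)
    (h : ∀ l r : LTree Bool, (LTree.node l r).wcoeff a •
      (LTree.node l r).Z (labelValues x y) = 0) :
    starTrunc a N x y = x + y := by
  classical
  have hs : ({LTree.leaf true, LTree.leaf false} : Finset (LTree Bool)) ⊆ LTree.smallTrees Bool N := by
    intro T hT
    simp only [Finset.mem_insert, Finset.mem_singleton] at hT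
    rcases hT with rfl | rfl <;> simp [LTree.leaves] <;> omega
  rw [starTrunc, ← Finset.sum_subset hs]
  · rw [Finset.sum_pair (by simp)]
    simp [LTree.Z, labelValues]
  · rintro (c | ⟨l, r⟩) _ hT
    · cases c <;> simp at hT
    · exact h l r

theorem starTrunc_of_lie_eq_zero (a : ℕ → K) {N : ℕ} (hN : 2 ≤ N) {x y : L} (h : ⁅x, y⁆ = 0) :
    starTrunc a N x y = x + y := by
  refine starTrunc_of_node_eq_zero a hN x y fun l r => ?_
  rw [LTree.Z_node_eq_zero, smul_zero]
  have h' : ⁅y, x⁆ = 0 := by rw [← lie_skew, h, neg_zero]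
  rintro (_ | _) (_ | _) <;> simp [labelValues, h, h']

/-! ### The differential equation -/

theorem LTree.deriv_Z (D : L →ₗ[K] L) (hD : ∀ u v, D ⁅u, v⁆ = ⁅D u, v⁆ + ⁅u, D v⁆) {x y : L}
    (hx : D x = x) (hy : D y = 0) (T : LTree Bool) :
    D (T.Z (labelValues x y)) = (T.leaves.count true : K) • T.Z (labelValues x y) := by
  induction T with
  | leaf c => cases c <;> simp [LTree.Z, LTree.leaves, labelValues, hx, hy]
  | node l r ihl ihr =>
    simp only [LTree.Z, hD, ihl, ihr, LTree.leaves, List.count_append, Nat.cast_add, add_smul,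
      smul_lie, lie_smul]

open Classical in
/-- The sum over the trees with fewer than `N` leaves whose rightmost branch has length `k` and
ends in a leaf with the greater label, without the contribution of the root to the coefficient. -/
noncomputable def spineSum (a : ℕ → K) (N k : ℕ) (x y : L) : L :=
  ∑ T ∈ LTree.smallTrees Bool N with T.mLabel = true ∧ T.d = k,
    T.spineCoeff a • T.Z (labelValues x y)

theorem deriv_starTrunc [CharZero K] (a : ℕ → K) (N : ℕ) (D : L →ₗ[K] L)
    (hD : ∀ u v, D ⁅u, v⁆ = ⁅D u, v⁆ + ⁅u, D v⁆) {x y : L} (hx : D x = x) (hy : D y = 0) :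
    D (starTrunc a N x y) = ∑ k ∈ Finset.range N, LTree.withOne a k • spineSum a N k x y := by
  classical
  simp only [starTrunc, map_sum, map_smul, LTree.deriv_Z D hD hx hy, smul_smul, spineSum,
    Finset.smul_sum, Finset.sum_filter]
  rw [Finset.sum_comm]
  refine Finset.sum_congr rfl fun T hT => ?_
  have hd : T.d ∈ Finset.range N := by
    have := T.d_lt_leaves_length
    rw [LTree.mem_smallTrees] at hT
    simp only [Finset.mem_range]; omega
  rw [mul_comm, LTree.count_mul_wcoeff, Finset.sum_eq_single_of_mem _ hd]
  · by_cases h : T.mLabel = true <;> simp [h, smul_smul]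
  · intro k _ hk
    simp [hk.symm]

theorem spineSum_zero (I : LieFiltration K L) (a : ℕ → K) (N : ℕ) {x y : L}
    (hx : x ∈ I.toFun 1) : spineSum a N 0 x y - x ∈ I.toFun N := by
  classical
  have hcond : ∀ T : LTree Bool, (T.mLabel = true ∧ T.d = 0) ↔ T = LTree.leaf true := by
    rintro (c | ⟨l, r⟩) <;> simp [LTree.mLabel, LTree.d]
  simp only [spineSum, hcond, Finset.sum_filter, Finset.sum_ite_eq']
  by_cases hN : 1 < N
  · simp [LTree.leaves, hN, LTree.Z, labelValues]
  -- For `N ≤ 1` the one-leaf tree is itself cut off and the difference is `-x`.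
  · simp only [LTree.mem_smallTrees, LTree.leaves, List.length_singleton, hN, if_false, zero_sub]
    exact Submodule.neg_mem _ (I.anti (by omega) hx)

/-- Splitting a tree at its root is a bijection onto pairs of a left subtree, which is arbitrary,
and a right subtree with a branch shorter by one. The bracket also contains pairs whose total size
reaches `N`; these form the error term. -/
theorem spineSum_succ (I : LieFiltration K L) (a : ℕ → K) (N k : ℕ) {x y : L}
    (hx : x ∈ I.toFun 1) (hy : y ∈ I.toFun 1) :
    spineSum a N (k + 1) x y - ⁅starTrunc a N x y, spineSum a N k x y⁆ ∈ I.toFun N := by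
  classical
  set B := LTree.smallTrees Bool N with hB
  set f : LTree Bool → L := fun T => T.spineCoeff a • T.Z (labelValues x y) with hf
  set P := B ×ˢ {T ∈ B | T.mLabel = true ∧ T.d = k} with hP
  have hlie : ⁅starTrunc a N x y, spineSum a N k x y⁆ =
      ∑ p ∈ P, f (LTree.node p.1 p.2) := by
    rw [starTrunc, spineSum, hP, Finset.sum_product, sum_lie]
    refine Finset.sum_congr rfl fun l _ => ?_
    rw [lie_sum]
    refine Finset.sum_congr rfl fun r _ => ?_
    rw [hf]
    simp only [LTree.spineCoeff_node, LTree.Z, smul_lie, lie_smul, smul_smul]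
    rw [mul_comm]
  have hspine : spineSum a N (k + 1) x y =
      ∑ p ∈ P with LTree.node p.1 p.2 ∈ B, f (LTree.node p.1 p.2) := by
    symm
    refine Finset.sum_bij (fun p _ => LTree.node p.1 p.2) ?_ ?_ ?_ ?_
    · rintro ⟨l, r⟩ h
      simp only [hP, Finset.mem_filter, Finset.mem_product] at h ⊢
      exact ⟨h.2, h.1.2.2.1, by simp [LTree.d, h.1.2.2.2]⟩
    · rintro ⟨l, r⟩ _ ⟨l', r'⟩ _ h
      simpa using h
    · rintro (c | ⟨l, r⟩) h
      · simp [LTree.d] at h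
      · have hl := l.leaves_length_pos
        have hr := r.leaves_length_pos
        simp only [Finset.mem_filter, LTree.mem_smallTrees, LTree.leaves, List.length_append,
          LTree.mLabel, LTree.d, Nat.add_right_cancel_iff] at h
        refine ⟨(l, r), ?_, rfl⟩
        simp only [hP, hB, Finset.mem_filter, Finset.mem_product, LTree.mem_smallTrees, LTree.leaves,
          List.length_append]
        exact ⟨⟨by omega, by omega, h.2⟩, h.1⟩
    · intro p _
      rfl
  rw [hlie, hspine, ← Finset.sum_filter_add_sum_filter_not P fun p => LTree.node p.1 p.2 ∈ B,
    sub_add_cancel_left]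
  refine Submodule.neg_mem _ (Submodule.sum_mem _ fun p hp => Submodule.smul_mem _ _ ?_)
  refine I.anti ?_ (LTree.Z_mem I (labelValues_mem hx hy) _)
  simpa [hB] using (Finset.mem_filter.mp hp).2

theorem spineSum_sub_ad_pow (I : LieFiltration K L) (a : ℕ → K) (N k : ℕ) {x y : L}
    (hx : x ∈ I.toFun 1) (hy : y ∈ I.toFun 1) :
    spineSum a N k x y - (LieAlgebra.ad K L (starTrunc a N x y) ^ k) x ∈ I.toFun N := by
  induction k with
  | zero => simpa using spineSum_zero I a N (y := y) hx
  | succ k ih =>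
    have h1 := spineSum_succ I a N k hx hy
    have h2 := I.lie_mem (I.anti (Nat.zero_le _) (starTrunc_mem I a N hx hy)) ih
    rw [zero_add] at h2
    rw [pow_succ', Module.End.mul_apply, LieAlgebra.ad_apply]
    have := Submodule.add_mem _ h1 h2
    rwa [lie_sub, sub_add_sub_cancel] at this

/-- If `D` is a derivation with `D x = x` and `D y = 0`, then `P = x ∗ y` satisfies
`D P = ∑ a_k (ad P)^k x`, with `a_0 = 1`. -/
theorem deriv_starTrunc_sub_mem [CharZero K] (I : LieFiltration K L) (a : ℕ → K) (N : ℕ)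
    (D : L →ₗ[K] L) (hD : ∀ u v, D ⁅u, v⁆ = ⁅D u, v⁆ + ⁅u, D v⁆) {x y : L}
    (hx : x ∈ I.toFun 1) (hy : y ∈ I.toFun 1) (hDx : D x = x) (hDy : D y = 0) :
    D (starTrunc a N x y) - ∑ k ∈ Finset.range N,
      LTree.withOne a k • (LieAlgebra.ad K L (starTrunc a N x y) ^ k) x ∈ I.toFun N := by
  rw [deriv_starTrunc a N D hD hDx hDy, ← Finset.sum_sub_distrib]
  simp only [← smul_sub]
  exact Submodule.sum_mem _ fun k _ => Submodule.smul_mem _ _ (spineSum_sub_ad_pow I a N k hx hy)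

end Trunc

/-! ### Truncated exponential and logarithm -/

section ExpLog

variable (K : Type*) [Field K]

/-- The exponential series, truncated below degree `N`. -/
noncomputable def truncExp {R : Type*} [Ring R] [Algebra K R] (N : ℕ) (p : R) : R :=
  ∑ k ∈ Finset.range N, ((k.factorial : K)⁻¹) • p ^ k

/-- The series of `log (1 + q)`, truncated below degree `N`. -/
noncomputable def truncLog {R : Type*} [Ring R] [Algebra K R] (N : ℕ) (q : R) : R :=
  ∑ k ∈ Finset.Ico 1 N, ((-1 : K) ^ (k - 1) / (k : K)) • q ^ k

variable {K}

theorem map_truncExp {R S : Type*} [Ring R] [Algebra K R] [Ring S] [Algebra K S] (f : R →ₐ[K] S)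
    (N : ℕ) (p : R) : f (truncExp K N p) = truncExp K N (f p) := by
  simp [truncExp]

theorem map_truncLog {R S : Type*} [Ring R] [Algebra K R] [Ring S] [Algebra K S] (f : R →ₐ[K] S)
    (N : ℕ) (p : R) : f (truncLog K N p) = truncLog K N (f p) := by
  simp [truncLog]

open Polynomial

theorem derivative_truncExp_X [CharZero K] (n : ℕ) :
    derivative (truncExp K (n + 1) (X : K[X])) = truncExp K n X := by
  simp only [truncExp, derivative_sum, derivative_smul, derivative_X_pow]
  rw [Finset.sum_range_succ']
  simp only [Nat.cast_zero, zero_mul, C_0, smul_zero, add_zero, Nat.add_sub_cancel]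
  refine Finset.sum_congr rfl fun k _ => ?_
  rw [← smul_eq_C_mul, smul_smul]
  congr 1
  have : ((k + 1 : ℕ) : K) ≠ 0 := Nat.cast_ne_zero.mpr k.succ_ne_zero
  have h2 : (k.factorial : K) ≠ 0 := Nat.cast_ne_zero.mpr k.factorial_ne_zero
  rw [Nat.factorial_succ, Nat.cast_mul]
  field_simp

theorem derivative_truncLog [CharZero K] (n : ℕ) (u : K[X]) :
    derivative (truncLog K (n + 1) u) = derivative u * ∑ j ∈ Finset.range n, (-u) ^ j := by
  simp only [truncLog, derivative_sum, derivative_smul, derivative_pow]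
  rw [Finset.sum_Ico_eq_sum_range, Finset.mul_sum]
  refine Finset.sum_congr rfl fun k _ => ?_
  have h : ((1 + k : ℕ) : K) ≠ 0 := Nat.cast_ne_zero.mpr (by omega)
  rw [Nat.add_sub_cancel_left, ← smul_eq_C_mul, smul_mul_assoc, smul_smul, div_mul_cancel₀ _ h,
    neg_pow, smul_eq_C_mul, one_pow, mul_one, map_pow, map_neg, map_one]
  ring

/-- The difference `f` has no constant term, so in characteristic zero it suffices that `X ^ n`
divides its derivative. The geometric sum for `1/E` makes `E * f'` divisible by `X ^ n`, and `E` has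
constant term `1`, hence is coprime to `X`. -/
theorem X_pow_dvd_truncLog_truncExp [CharZero K] (N : ℕ) :
    (X : K[X]) ^ N ∣ truncLog K N (truncExp K N X - 1) - X := by
  cases N with
  | zero => simp
  | succ n =>
    set E : K[X] := truncExp K (n + 1) X with hE
    set f : K[X] := truncLog K (n + 1) (E - 1) - X with hf
    have hXE : (X : K[X]) ∣ E - 1 := by
      rw [hE, truncExp, Finset.sum_range_succ']
      simp only [Nat.factorial_zero, Nat.cast_one, inv_one, pow_zero, one_smul,
        add_sub_cancel_right]
      exact Finset.dvd_sum fun k _ => dvd_smul_of_dvd _ (dvd_pow_self _ k.succ_ne_zero)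
    have hE' : derivative (E - 1) = E - ((n.factorial : K)⁻¹) • X ^ n := by
      rw [derivative_sub, derivative_one, sub_zero, hE, derivative_truncExp_X, truncExp, truncExp,
        Finset.sum_range_succ, add_sub_cancel_right]
    have hgeom : E * ∑ j ∈ Finset.range n, (-(E - 1)) ^ j = 1 - (-(E - 1)) ^ n := by
      have := mul_neg_geom_sum (-(E - 1)) n
      rwa [sub_neg_eq_add, add_sub_cancel] at this
    have hkey : E * derivative f =
        -(((n.factorial : K)⁻¹) • X ^ n) - derivative (E - 1) * (-(E - 1)) ^ n := by
      rw [hf, derivative_sub, derivative_X, derivative_truncLog, mul_sub, mul_one, mul_left_comm,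
        hgeom, mul_sub, mul_one, hE']
      ring
    have hdvd : (X : K[X]) ^ n ∣ E * derivative f := by
      rw [hkey]
      refine dvd_sub (Dvd.dvd.neg_right ?_) (Dvd.dvd.mul_left ?_ _)
      · exact dvd_smul_of_dvd _ dvd_rfl
      · exact pow_dvd_pow_of_dvd (Dvd.dvd.neg_right hXE) n
    have hcop : IsCoprime ((X : K[X]) ^ n) E := by
      refine IsCoprime.pow_left ?_
      obtain ⟨g, hg⟩ := hXE
      exact ⟨-g, 1, by linear_combination hg⟩
    have hdf : (X : K[X]) ^ n ∣ derivative f := hcop.dvd_of_dvd_mul_left hdvd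
    have h0 : f.coeff 0 = 0 := by
      rw [← X_dvd_iff, hf, truncLog]
      refine dvd_sub (Finset.dvd_sum fun k hk => dvd_smul_of_dvd _ ?_) dvd_rfl
      exact dvd_pow hXE (by have := (Finset.mem_Ico.mp hk).1; omega)
    rw [X_pow_dvd_iff] at hdf ⊢
    intro d hd
    cases d with
    | zero => exact h0
    | succ d =>
      have := hdf d (by omega)
      rw [coeff_derivative, mul_eq_zero] at this
      exact this.resolve_right (by exact_mod_cast d.succ_ne_zero)

theorem truncLog_truncExp [CharZero K] {R : Type*} [Ring R] [Algebra K R] {N : ℕ} {p : R}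
    (hp : p ^ N = 0) : truncLog K N (truncExp K N p - 1) = p := by
  obtain ⟨g, hg⟩ := X_pow_dvd_truncLog_truncExp (K := K) N
  have := congrArg (aeval p) hg
  rw [map_sub, map_truncLog, map_sub, map_truncExp, map_one, aeval_X, map_mul, map_pow, aeval_X,
    hp, zero_mul] at this
  exact sub_eq_zero.mp this

end ExpLog

/-! ### Bernoulli numbers -/

section Bernoulli

open PowerSeries

variable (K : Type*) [Field K]

theorem bernCoeff_zero : bernCoeff K 0 = 1 := by simp [bernCoeff]

variable [CharZero K]

theorem mk_bernCoeff_mul_exp_sub_one :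
    PowerSeries.mk (bernCoeff K) * (PowerSeries.exp K - 1) = X := by
  have : PowerSeries.mk (bernCoeff K) = bernoulliPowerSeries K := by
    ext n
    simp [bernCoeff, bernoulliPowerSeries]
  rw [this, bernoulliPowerSeries_mul_exp_sub_one]

theorem sum_antidiagonal_bernCoeff (n : ℕ) :
    ∑ p ∈ antidiagonal n, ((p.1 + 1).factorial : K)⁻¹ * bernCoeff K p.2 =
      if n = 0 then 1 else 0 := by
  have h := congrArg (coeff (n + 1)) (mk_bernCoeff_mul_exp_sub_one K)
  rw [mul_comm, coeff_mul, Finset.Nat.sum_antidiagonal_succ] at h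
  simp only [map_sub, coeff_exp, coeff_one, coeff_mk, coeff_X] at h
  simp only [Nat.factorial_zero, Nat.cast_one, div_one, map_one, if_true, sub_self, zero_mul,
    zero_add, Nat.add_eq_zero_iff, one_ne_zero, and_false, if_false, sub_zero,
    Nat.add_eq_right] at h
  rw [← h]
  refine Finset.sum_congr rfl fun p _ => ?_
  simp

/-- Differentiate `f (E - 1) = X`, multiply by `X`, replace `f E` by `f + X`, and cancel `E - 1`. -/
theorem mk_bernCoeff_riccati :
    X * d⁄dX K (PowerSeries.mk (bernCoeff K)) =
      PowerSeries.mk (bernCoeff K) - PowerSeries.mk (bernCoeff K) *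
        (PowerSeries.mk (bernCoeff K) + X) := by
  set f := PowerSeries.mk (bernCoeff K)
  set E := PowerSeries.exp K
  have h : f * (E - 1) = X := mk_bernCoeff_mul_exp_sub_one K
  have hd := congrArg (d⁄dX K) h
  rw [Derivation.leibniz, map_sub, derivative_exp, derivative_one, derivative_X, smul_eq_mul,
    smul_eq_mul, sub_zero] at hd
  have hE : E - 1 ≠ 0 := fun h0 => X_ne_zero (by rw [← h, h0, mul_zero])
  refine mul_right_cancel₀ hE ?_
  linear_combination (X : K⟦X⟧) * hd + (f - 1) * h

/-- Both sides equal `f E`, since `E(-X)` is the inverse of `E`. -/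
theorem evalNegHom_mk_bernCoeff :
    evalNegHom (PowerSeries.mk (bernCoeff K)) = PowerSeries.mk (bernCoeff K) + X := by
  set f := PowerSeries.mk (bernCoeff K)
  set E := PowerSeries.exp K
  have h : f * (E - 1) = X := mk_bernCoeff_mul_exp_sub_one K
  have hE : E - 1 ≠ 0 := fun h0 => X_ne_zero (by rw [← h, h0, mul_zero])
  have hn := congrArg evalNegHom h
  rw [map_mul, map_sub, map_one, evalNegHom_X] at hn
  have he : E * evalNegHom E = 1 := exp_mul_exp_neg_eq_one
  refine mul_right_cancel₀ hE ?_
  linear_combination (-E) * hn + evalNegHom f * he - h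

theorem succ_mul_bernCoeff (n : ℕ) :
    ((n : K) + 1) * bernCoeff K (n + 1) = bernCoeff K (n + 1) -
      ∑ p ∈ antidiagonal (n + 1), bernCoeff K p.1 * bernCoeff K p.2 - bernCoeff K n := by
  have h := congrArg (coeff (n + 1)) (mk_bernCoeff_riccati K)
  rw [mul_add, coeff_succ_X_mul, coeff_derivative, map_sub, map_add, coeff_succ_mul_X,
    coeff_mul] at h
  simp only [coeff_mk] at h
  linear_combination h

theorem neg_one_pow_mul_bernCoeff (n : ℕ) :
    (-1) ^ n * bernCoeff K n = bernCoeff K n + if n = 1 then 1 else 0 := by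
  have h := congrArg (coeff n) (evalNegHom_mk_bernCoeff K)
  rwa [evalNegHom, coeff_rescale, map_add, coeff_X, coeff_mk] at h

theorem neg_one_mul_self_pow {R : Type*} [CommRing R] (n : ℕ) : (-1 : R) ^ n * (-1) ^ n = 1 := by
  rw [← mul_pow]; simp

/-- The recursion for the numbers `b_n` and for their multiples `h^n b_n`. -/
theorem bernCoeff_recursion (h : K) {n : ℕ} (hn : 0 < n) :
    (1 + (n : K) * (-1) ^ n) * (h ^ n * bernCoeff K n) =
      -∑ i ∈ Finset.Ico 1 n, (-1) ^ i * (h ^ i * bernCoeff K i) *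
        (h ^ (n - i) * bernCoeff K (n - i)) := by
  obtain ⟨m, rfl⟩ : ∃ m, n = m + 1 := ⟨n - 1, by omega⟩
  have h1 := succ_mul_bernCoeff K m
  have h2 : ∑ p ∈ antidiagonal (m + 1), (-1) ^ p.1 * bernCoeff K p.1 * bernCoeff K p.2 =
      ∑ p ∈ antidiagonal (m + 1), bernCoeff K p.1 * bernCoeff K p.2 + bernCoeff K m := by
    simp only [neg_one_pow_mul_bernCoeff, add_mul, Finset.sum_add_distrib]
    congr 1
    rw [Finset.sum_eq_single_of_mem ((1, m) : ℕ × ℕ) (mem_antidiagonal.mpr (by simp [add_comm]))]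
    · simp
    · rintro ⟨i, j⟩ hp hne
      rw [mem_antidiagonal] at hp
      have : i ≠ 1 := by
        rintro rfl
        exact hne (by simp at hp ⊢; omega)
      simp [this]
  -- Exchanging the two factors multiplies the alternating sum by `(-1)^n`, so it vanishes for odd
  -- `n`. This reconciles the factor `n + (-1)^n` coming from the Riccati equation with the factor
  -- `1 + n (-1)^n` of the recursion.
  have hsymm : (-1 : K) ^ (m + 1) *
      ∑ p ∈ antidiagonal (m + 1), (-1) ^ p.1 * bernCoeff K p.1 * bernCoeff K p.2 =
      ∑ p ∈ antidiagonal (m + 1), (-1) ^ p.1 * bernCoeff K p.1 * bernCoeff K p.2 := by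
    rw [Finset.mul_sum, ← Finset.Nat.sum_antidiagonal_swap]
    refine Finset.sum_congr rfl fun p hp => ?_
    rw [← mem_antidiagonal.mp hp, pow_add, Prod.fst_swap, Prod.snd_swap]
    have := neg_one_mul_self_pow (R := K) p.2
    linear_combination (-1) ^ p.1 * bernCoeff K p.1 * bernCoeff K p.2 * this
  rw [h2] at hsymm
  rw [Finset.Nat.sum_antidiagonal_eq_sum_range_succ
    (fun i j => (-1) ^ i * bernCoeff K i * bernCoeff K j), Finset.range_eq_Ico,
    Finset.sum_Ico_succ_top (by omega), Finset.sum_eq_sum_Ico_succ_bot (by omega)] at h2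
  simp only [bernCoeff_zero, Nat.sub_self, Nat.sub_zero, pow_zero, zero_add, mul_one, one_mul] at h2
  have h3 : ∑ i ∈ Finset.Ico 1 (m + 1), (-1) ^ i * (h ^ i * bernCoeff K i) *
        (h ^ (m + 1 - i) * bernCoeff K (m + 1 - i)) =
      h ^ (m + 1) * ∑ i ∈ Finset.Ico 1 (m + 1),
        (-1) ^ i * bernCoeff K i * bernCoeff K (m + 1 - i) := by
    rw [Finset.mul_sum]
    refine Finset.sum_congr rfl fun i hi => ?_
    have : h ^ (m + 1) = h ^ i * h ^ (m + 1 - i) := by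
      rw [← pow_add]; congr 1; have := Finset.mem_Ico.mp hi; omega
    rw [this]; ring
  rw [h3]
  push_cast
  linear_combination (h ^ (m + 1) * (-1) ^ (m + 1)) * h1 + h ^ (m + 1) * h2 - h ^ (m + 1) * hsymm

end Bernoulli

/-! ### Double sums -/

theorem sum_range_sum_range_eq_sum_antidiagonal {M : Type*} [AddCommMonoid M] (N : ℕ)
    (F : ℕ → ℕ → M) (hF : ∀ i j, N ≤ i + j → F i j = 0) :
    ∑ i ∈ Finset.range N, ∑ j ∈ Finset.range N, F i j =
      ∑ n ∈ Finset.range N, ∑ p ∈ antidiagonal n, F p.1 p.2 := by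
  rw [← Finset.sum_product', Finset.sum_sigma']
  symm
  refine Finset.sum_bij_ne_zero (fun p _ _ => p.2) ?_ ?_ ?_ ?_
  · rintro ⟨n, i, j⟩ h _
    simp only [Finset.mem_sigma, Finset.mem_range, mem_antidiagonal, Finset.mem_product]
      at h ⊢
    omega
  · rintro ⟨n, i, j⟩ h _ ⟨n', i', j'⟩ h' _ heq
    simp only [Finset.mem_sigma, mem_antidiagonal] at h h'
    obtain ⟨rfl, rfl⟩ := Prod.mk.inj heq
    obtain ⟨-, rfl⟩ := h
    obtain ⟨-, rfl⟩ := h'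
    rfl
  · rintro ⟨i, j⟩ _ hne
    refine ⟨⟨i + j, i, j⟩, ?_, hne, rfl⟩
    simp only [Finset.mem_sigma, Finset.mem_range, mem_antidiagonal, and_true]
    by_contra hc
    exact hne (hF i j (by omega))
  · rintro ⟨n, i, j⟩ _ _
    rfl

/-! ### Filtered rings -/

/-- A decreasing filtration of an associative algebra that is compatible with the product. -/
structure RingFiltration (K R : Type*) [Field K] [Ring R] [Algebra K R] where
  toFun : ℕ → Submodule K R
  anti : Antitone toFun
  mem_zero : ∀ x, x ∈ toFun 0
  mul_mem : ∀ {m n : ℕ} {x y : R}, x ∈ toFun m → y ∈ toFun n → x * y ∈ toFun (m + n)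

section Filtered

attribute [local instance 100] LieRing.ofAssociativeRing

variable {K : Type*} [Field K] {R : Type*} [Ring R] [Algebra K R]

/-- A filtration of an associative algebra as a filtration for the commutator bracket. -/
def RingFiltration.toLie (I : RingFiltration K R) : LieFiltration K R where
  toFun := I.toFun
  anti := I.anti
  lie_mem {m n x y} hx hy := by
    rw [LieRing.of_associative_ring_bracket]
    exact Submodule.sub_mem _ (I.mul_mem hx hy) (add_comm m n ▸ I.mul_mem hy hx)

theorem RingFiltration.pow_mem (I : RingFiltration K R) {p : R} (hp : p ∈ I.toFun 1) (n : ℕ) :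
    p ^ n ∈ I.toFun n := by
  induction n with
  | zero => simpa using I.mem_zero 1
  | succ n ih => rw [pow_succ]; exact I.mul_mem ih hp

theorem LieFiltration.ad_pow_mem {L : Type*} [LieRing L] [LieAlgebra K L] (I : LieFiltration K L)
    {p v : L} (hp : p ∈ I.toFun 1) (hv : v ∈ I.toFun 1) (n : ℕ) :
    (LieAlgebra.ad K L p ^ n) v ∈ I.toFun (n + 1) := by
  induction n with
  | zero => simpa using hv
  | succ n ih =>
    rw [pow_succ', Module.End.mul_apply, LieAlgebra.ad_apply, add_comm (n + 1)]
    exact I.lie_mem hp ih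

/-- In the product rule the powers of `P` to the left of `D P` are moved to its right by `P Q = [P,
Q] + Q P`; the multiplicities obey Pascal's rule. -/
theorem leibniz_pow_succ (D : R →ₗ[K] R) (hD : ∀ u v, D (u * v) = D u * v + u * D v) (P : R) (k : ℕ) :
    D (P ^ (k + 1)) = ∑ p ∈ antidiagonal k,
      ((k + 1).choose (p.1 + 1) : K) • ((LieAlgebra.ad K R P ^ p.1) (D P) * P ^ p.2) := by
  have hmul : ∀ (i : ℕ), P * (LieAlgebra.ad K R P ^ i) (D P) =
      (LieAlgebra.ad K R P ^ (i + 1)) (D P) + (LieAlgebra.ad K R P ^ i) (D P) * P := by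
    intro i
    rw [pow_succ' _ i, Module.End.mul_apply, LieAlgebra.ad_apply,
      LieRing.of_associative_ring_bracket, sub_add_cancel]
  induction k with
  | zero => simp
  | succ k ih =>
    rw [pow_succ' P (k + 1), hD, ih, Finset.mul_sum]
    simp only [mul_smul_comm, ← mul_assoc, hmul, add_mul, smul_add, Finset.sum_add_distrib]
    simp only [mul_assoc, ← pow_succ']
    have hsplit : ∀ i j : ℕ, (((k + 1 + 1).choose (i + 1) : ℕ) : K) =
        ((k + 1).choose (i + 1) : K) + ((k + 1).choose i : K) := by
      intro i j
      rw [Nat.choose_succ_succ, Nat.cast_add, add_comm]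
    simp only [hsplit _ 0, add_smul, Finset.sum_add_distrib]
    rw [Finset.Nat.sum_antidiagonal_succ' (n := k)
      (f := fun p => (((k + 1).choose (p.1 + 1) : ℕ) : K) •
        ((LieAlgebra.ad K R P ^ p.1) (D P) * P ^ p.2)),
      Finset.Nat.sum_antidiagonal_succ (n := k)
      (f := fun p => (((k + 1).choose p.1 : ℕ) : K) •
        ((LieAlgebra.ad K R P ^ p.1) (D P) * P ^ p.2))]
    simp only [Nat.choose_succ_self, Nat.cast_zero, zero_smul, zero_add, Nat.choose_zero_right,
      Nat.cast_one, one_smul, pow_zero, Module.End.one_apply, mul_one]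
    abel

/-- This is the classical formula `D (e^P) = ((e^t - 1)/t)(D P) · e^P` with `t = ad P`: dividing the
binomial coefficient of `leibniz_pow_succ` by `(k + 1)!` separates the two factorials. -/
theorem deriv_truncExp [CharZero K] (I : RingFiltration K R) {N : ℕ} (hN : I.toFun N = ⊥)
    (D : R →ₗ[K] R) (hD : ∀ u v, D (u * v) = D u * v + u * D v) {P : R} (hP : P ∈ I.toFun 1)
    (hDP : D P ∈ I.toFun 1) :
    D (truncExp K N P) = (∑ i ∈ Finset.range N, (((i + 1).factorial : K)⁻¹) •
      (LieAlgebra.ad K R P ^ i) (D P)) * truncExp K N P := by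
  have hPN : P ^ N = 0 := by
    have := I.pow_mem hP N
    rwa [hN, Submodule.mem_bot] at this
  have hD1 : D 1 = 0 := by simpa using hD 1 1
  -- One more (vanishing) term compensates for the constant term that differentiation removes.
  have h1 : truncExp K N P = truncExp K (N + 1) P := by
    rw [truncExp, truncExp, Finset.sum_range_succ, hPN, smul_zero, add_zero]
  have h2 : D (truncExp K N P) = ∑ n ∈ Finset.range N, ∑ p ∈ antidiagonal n,
      (((p.1 + 1).factorial : K)⁻¹ * (p.2.factorial : K)⁻¹) •
        ((LieAlgebra.ad K R P ^ p.1) (D P) * P ^ p.2) := by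
    rw [h1, truncExp, map_sum, Finset.sum_range_succ']
    simp only [map_smul, pow_zero, hD1, smul_zero, add_zero, leibniz_pow_succ D hD, Finset.smul_sum]
    refine Finset.sum_congr rfl fun n _ => Finset.sum_congr rfl fun p hp => ?_
    rw [mem_antidiagonal] at hp
    rw [smul_smul]
    congr 1
    have hle : p.1 + 1 ≤ n + 1 := by omega
    have h3 : n + 1 - (p.1 + 1) = p.2 := by omega
    have h4 : ∀ m : ℕ, (m.factorial : K) ≠ 0 := fun m => Nat.cast_ne_zero.mpr m.factorial_ne_zero
    have h5 := Nat.choose_mul_factorial_mul_factorial hle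
    rw [h3] at h5
    rw [← h5]
    push_cast
    have h6 : (((n + 1).choose (p.1 + 1) : ℕ) : K) ≠ 0 :=
      Nat.cast_ne_zero.mpr (Nat.choose_pos hle).ne'
    have := h4 (p.1 + 1)
    have := h4 p.2
    field_simp
  rw [h2, ← sum_range_sum_range_eq_sum_antidiagonal N
    (fun i j => (((i + 1).factorial : K)⁻¹ * (j.factorial : K)⁻¹) •
        ((LieAlgebra.ad K R P ^ i) (D P) * P ^ j)), truncExp, Finset.sum_mul]
  · refine Finset.sum_congr rfl fun i _ => ?_
    rw [Finset.mul_sum]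
    refine Finset.sum_congr rfl fun j _ => ?_
    rw [smul_mul_smul_comm]
  · intro i j hij
    have := I.mul_mem (I.toLie.ad_pow_mem hP hDP i) (I.pow_mem hP j)
    have h0 := I.anti (show N ≤ i + 1 + j by omega) this
    rw [hN, Submodule.mem_bot] at h0
    rw [h0, smul_zero]

/-- The power series `(e^t - 1)/t` and `t/(e^t - 1)`, evaluated at the nilpotent operator `ad P`,
are inverse to each other. -/
theorem sum_ad_pow_sum_bernCoeff [CharZero K] {L : Type*} [LieRing L] [LieAlgebra K L]
    (I : LieFiltration K L) {N : ℕ} (hN : I.toFun N = ⊥) {P x : L} (hP : P ∈ I.toFun 1)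
    (hx : x ∈ I.toFun 1) :
    ∑ i ∈ Finset.range N, (((i + 1).factorial : K)⁻¹) • (LieAlgebra.ad K L P ^ i)
      (∑ k ∈ Finset.range N, bernCoeff K k • (LieAlgebra.ad K L P ^ k) x) = x := by
  have h0 : ∀ n, N ≤ n → (LieAlgebra.ad K L P ^ n) x = 0 := by
    intro n hn
    have := I.anti (show N ≤ n + 1 by omega) (I.ad_pow_mem hP hx n)
    rwa [hN, Submodule.mem_bot] at this
  simp only [map_sum, map_smul, Finset.smul_sum, smul_smul]
  simp only [← Module.End.mul_apply, ← pow_add]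
  rw [sum_range_sum_range_eq_sum_antidiagonal N
    (fun i k => (((i + 1).factorial : K)⁻¹ * bernCoeff K k) • (LieAlgebra.ad K L P ^ (i + k)) x)]
  · have : ∀ n, ∑ p ∈ antidiagonal n, (((p.1 + 1).factorial : K)⁻¹ * bernCoeff K p.2) •
        (LieAlgebra.ad K L P ^ (p.1 + p.2)) x =
        (if n = 0 then (1 : K) else 0) • (LieAlgebra.ad K L P ^ n) x := by
      intro n
      rw [← sum_antidiagonal_bernCoeff, Finset.sum_smul]
      refine Finset.sum_congr rfl fun p hp => ?_
      rw [mem_antidiagonal.mp hp]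
    simp only [this, ite_smul, zero_smul, one_smul, Finset.sum_ite_eq', Finset.mem_range]
    split_ifs with h
    · simp
    · have := h0 0 (by omega)
      simpa using this.symm
  · intro i j hij
    rw [h0 _ hij, smul_zero]

theorem withOne_bernCoeff : LTree.withOne (bernCoeff K) = bernCoeff K := by
  ext n
  rcases eq_or_ne n 0 with rfl | h
  · simp [LTree.withOne, bernCoeff_zero]
  · simp [LTree.withOne, h]

/-- If `D` is a derivation with `D x = x` and `D y = 0`, then `U = e^(x ∗ y)` satisfies
`D U = x U`, for the coefficients `b_n`. -/
theorem deriv_truncExp_starTrunc [CharZero K] (I : RingFiltration K R) {N : ℕ}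
    (hN : I.toFun N = ⊥) (D : R →ₗ[K] R) (hD : ∀ u v, D (u * v) = D u * v + u * D v) {x y : R}
    (hx : x ∈ I.toFun 1) (hy : y ∈ I.toFun 1) (hDx : D x = x) (hDy : D y = 0) :
    D (truncExp K N (starTrunc (bernCoeff K) N x y)) =
      x * truncExp K N (starTrunc (bernCoeff K) N x y) := by
  set P := starTrunc (bernCoeff K) N x y with hPdef
  have hP : P ∈ I.toFun 1 := starTrunc_mem I.toLie _ N hx hy
  have hDlie : ∀ u v : R, D ⁅u, v⁆ = ⁅D u, v⁆ + ⁅u, D v⁆ := by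
    intro u v
    simp only [LieRing.of_associative_ring_bracket, map_sub, hD]
    abel
  have hDP : D P = ∑ k ∈ Finset.range N, bernCoeff K k • (LieAlgebra.ad K R P ^ k) x := by
    have := deriv_starTrunc_sub_mem I.toLie (bernCoeff K) N D hDlie hx hy hDx hDy
    rw [withOne_bernCoeff] at this
    change _ ∈ I.toFun N at this
    rw [hN, Submodule.mem_bot] at this
    exact sub_eq_zero.mp this
  have hDP1 : D P ∈ I.toFun 1 := by
    rw [hDP]
    exact Submodule.sum_mem _ fun k _ => Submodule.smul_mem _ _
      (I.anti (by omega) (I.toLie.ad_pow_mem hP hx k))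
  rw [deriv_truncExp I hN D hD hP hDP1, hDP, sum_ad_pow_sum_bernCoeff I.toLie hN hP hx]

theorem deriv_truncExp_of_deriv_eq_self [CharZero K] (D : R →ₗ[K] R)
    (hD : ∀ u v, D (u * v) = D u * v + u * D v) {x : R} {N : ℕ} (hxN : x ^ N = 0)
    (hDx : D x = x) : D (truncExp K N x) = x * truncExp K N x := by
  have hD1 : D 1 = 0 := by simpa using hD 1 1
  have hpow : ∀ n : ℕ, D (x ^ n) = (n : K) • x ^ n := by
    intro n
    induction n with
    | zero => simp [hD1]
    | succ n ih =>
      rw [pow_succ, hD, ih, hDx, smul_mul_assoc, Nat.cast_succ, add_smul, one_smul]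
  have h1 : truncExp K N x = truncExp K (N + 1) x := by
    rw [truncExp, truncExp, Finset.sum_range_succ, hxN, smul_zero, add_zero]
  nth_rewrite 1 [h1]
  rw [truncExp, truncExp, map_sum, Finset.sum_range_succ', Finset.mul_sum]
  simp only [map_smul, pow_zero, hD1, smul_zero, add_zero, hpow]
  refine Finset.sum_congr rfl fun n _ => ?_
  rw [smul_smul, mul_smul_comm, ← pow_succ']
  congr 1
  have : ((n + 1 : ℕ) : K) ≠ 0 := Nat.cast_ne_zero.mpr n.succ_ne_zero
  have h2 : (n.factorial : K) ≠ 0 := Nat.cast_ne_zero.mpr n.factorial_ne_zero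
  rw [Nat.factorial_succ, Nat.cast_mul]
  field_simp

theorem deriv_truncExp_of_deriv_eq_zero (D : R →ₗ[K] R)
    (hD : ∀ u v, D (u * v) = D u * v + u * D v) {y : R} (N : ℕ) (hDy : D y = 0) :
    D (truncExp K N y) = 0 := by
  have hD1 : D 1 = 0 := by simpa using hD 1 1
  have hpow : ∀ n : ℕ, D (y ^ n) = 0 := by
    intro n
    induction n with
    | zero => simp [hD1]
    | succ n ih => rw [pow_succ, hD, ih, hDy, zero_mul, mul_zero, add_zero]
  simp [truncExp, hpow]

open Polynomial

/-- The filtration of `R[s]` by the coefficients. -/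
def RingFiltration.polynomial (I : RingFiltration K R) : RingFiltration K R[X] where
  toFun n :=
    { carrier := {p | ∀ i, p.coeff i ∈ I.toFun n}
      add_mem' := fun hp hq i => by rw [coeff_add]; exact Submodule.add_mem _ (hp i) (hq i)
      zero_mem' := fun i => by rw [coeff_zero]; exact Submodule.zero_mem _
      smul_mem' := fun c p hp i => by rw [coeff_smul]; exact Submodule.smul_mem _ _ (hp i) }
  anti := fun _ _ h _ hp i => I.anti h (hp i)
  mem_zero := fun _ _ => I.mem_zero _
  mul_mem := fun hp hq i => by
    rw [coeff_mul]
    exact Submodule.sum_mem _ fun _ _ => I.mul_mem (hp _) (hq _)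

/-- The derivation `s d/ds` of `R[s]`. -/
noncomputable def polynomialEuler (K : Type*) [Field K] (R : Type*) [Ring R] [Algebra K R] :
    R[X] →ₗ[K] R[X] where
  toFun p := X * derivative p
  map_add' p q := by rw [derivative_add, mul_add]
  map_smul' c p := by rw [derivative_smul, mul_smul_comm, RingHom.id_apply]

theorem coeff_polynomialEuler (p : R[X]) (n : ℕ) :
    (polynomialEuler K R p).coeff n = (n : K) • p.coeff n := by
  change (X * derivative p).coeff n = _
  cases n with
  | zero => simp
  | succ n =>
    rw [coeff_X_mul, coeff_derivative, ← Nat.cast_succ, ← Nat.cast_comm, ← nsmul_eq_mul,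
      Nat.cast_smul_eq_nsmul]

theorem polynomialEuler_mul (p q : R[X]) : polynomialEuler K R (p * q) =
    polynomialEuler K R p * q + p * polynomialEuler K R q := by
  change X * derivative (p * q) = X * derivative p * q + p * (X * derivative q)
  rw [derivative_mul, mul_add, ← mul_assoc, ← mul_assoc, ← mul_assoc, X_mul (p := p)]

/-- In a nilpotent algebra, `e^(x ∗ y) = e^x e^y` for the coefficients `b_n`. -/
theorem truncExp_starTrunc [CharZero K] (I : RingFiltration K R) {N : ℕ} (hN : I.toFun N = ⊥)
    (hN2 : 2 ≤ N) {x y : R} (hx : x ∈ I.toFun 1) (hy : y ∈ I.toFun 1) :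
    truncExp K N (starTrunc (bernCoeff K) N x y) = truncExp K N x * truncExp K N y := by
  have hJ : I.polynomial.toFun N = ⊥ := by
    rw [eq_bot_iff]
    intro p hp
    rw [Submodule.mem_bot]
    ext i
    have := hp i
    rwa [hN, Submodule.mem_bot] at this
  set D := polynomialEuler K R with hDdef
  have hD : ∀ u v, D (u * v) = D u * v + u * D v := polynomialEuler_mul
  -- The variable marks the occurrences of `x`, which provides a derivation fixing `x'` and killing
  -- `y'` even when `R` has none for `x` and `y`.
  set x' : R[X] := C x * X with hx'
  set y' : R[X] := C y with hy'
  have hx'1 : x' ∈ I.polynomial.toFun 1 := by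
    intro i
    rw [hx', coeff_C_mul_X]
    split_ifs
    · exact hx
    · exact Submodule.zero_mem _
  have hy'1 : y' ∈ I.polynomial.toFun 1 := by
    intro i
    rw [hy', coeff_C]
    split_ifs
    · exact hy
    · exact Submodule.zero_mem _
  have hDx : D x' = x' := by
    change X * derivative (C x * X) = C x * X
    rw [derivative_C_mul_X, X_mul]
  have hDy : D y' = 0 := by
    change X * derivative (C y) = 0
    rw [derivative_C, mul_zero]
  have hxN : x' ^ N = 0 := by
    have := I.polynomial.pow_mem hx'1 N
    rwa [hJ, Submodule.mem_bot] at this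
  set W := truncExp K N (starTrunc (bernCoeff K) N x' y') - truncExp K N x' * truncExp K N y'
    with hW
  have hDW : D W = x' * W := by
    rw [hW, map_sub, hD, deriv_truncExp_starTrunc I.polynomial hJ D hD hx'1 hy'1 hDx hDy,
      deriv_truncExp_of_deriv_eq_self D hD hxN hDx, deriv_truncExp_of_deriv_eq_zero D hD N hDy,
      mul_zero, add_zero, mul_sub, mul_assoc x' (truncExp K N x')]
  let ev0 : R[X] →ₐ[K] R := eval₂AlgHom (AlgHom.id K R) 0 fun a => Commute.zero_right a
  let ev1 : R[X] →ₐ[K] R := eval₂AlgHom (AlgHom.id K R) 1 fun a => Commute.one_right a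
  have hmap : ∀ f : R[X] →ₐ[K] R, f W = truncExp K N (starTrunc (bernCoeff K) N (f x') (f y')) -
      truncExp K N (f x') * truncExp K N (f y') := by
    intro f
    rw [hW, map_sub, map_mul, map_truncExp, map_truncExp, map_truncExp]
    congr 2
    exact starTrunc_map f.toLieHom _ N x' y'
  have hev0 : ∀ p, ev0 p = p.coeff 0 := by
    intro p
    change eval₂ (RingHom.id R) 0 p = _
    rw [← eval, coeff_zero_eq_eval_zero]
  -- Initial value: at `s = 0` the product `0 ∗ y` is `y`, and both exponentials agree.
  have hW0 : W.coeff 0 = 0 := by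
    rw [← hev0, hmap, hev0, hev0, hx', hy', coeff_C_zero, coeff_C_mul_X, if_neg zero_ne_one,
      starTrunc_of_lie_eq_zero _ hN2 (zero_lie y), zero_add]
    have : truncExp K N (0 : R) = 1 := by
      obtain ⟨M, rfl⟩ : ∃ M, N = M + 1 := ⟨N - 1, by omega⟩
      simp [truncExp, Finset.sum_range_succ']
    rw [this, one_mul, sub_self]
  -- In degree `n + 1` the equation `D W = x' W` reads `(n + 1) W_{n+1} = x W_n`.
  have hWn : ∀ n, W.coeff n = 0 := by
    intro n
    induction n with
    | zero => exact hW0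
    | succ n ih =>
      have h := congrArg (fun p : R[X] => p.coeff (n + 1)) hDW
      simp only [hDdef, coeff_polynomialEuler, hx', mul_assoc, coeff_C_mul, coeff_X_mul, ih,
        mul_zero, smul_eq_zero] at h
      exact h.resolve_left (Nat.cast_ne_zero.mpr n.succ_ne_zero)
  have hW00 : W = 0 := by ext n; rw [hWn, coeff_zero]
  have h1 := hmap ev1
  have hex : ev1 x' = x := by
    change eval₂ (RingHom.id R) 1 (C x * X) = x
    simp
  have hey : ev1 y' = y := by
    change eval₂ (RingHom.id R) 1 (C y) = y
    simp
  rw [hW00, map_zero, hex, hey] at h1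
  exact (sub_eq_zero.mp h1.symm)

end Filtered

section Associativity

attribute [local instance 100] LieRing.ofAssociativeRing

variable {K : Type*} [Field K] {R : Type*} [Ring R] [Algebra K R]

/-! ### Associativity and the logarithm in filtered rings -/

theorem starTrunc_eq_truncLog [CharZero K] (I : RingFiltration K R) {N : ℕ}
    (hN : I.toFun N = ⊥) (hN2 : 2 ≤ N) {x y : R} (hx : x ∈ I.toFun 1) (hy : y ∈ I.toFun 1) :
    starTrunc (bernCoeff K) N x y = truncLog K N (truncExp K N x * truncExp K N y - 1) := by
  have hP : starTrunc (bernCoeff K) N x y ∈ I.toFun 1 := starTrunc_mem I.toLie _ N hx hy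
  have hPN : starTrunc (bernCoeff K) N x y ^ N = 0 := by
    have := I.pow_mem hP N
    rwa [hN, Submodule.mem_bot] at this
  rw [← truncExp_starTrunc I hN hN2 hx hy, truncLog_truncExp hPN]

theorem starTrunc_assoc_of_nilpotent [CharZero K] (I : RingFiltration K R) {N : ℕ}
    (hN : I.toFun N = ⊥) (hN2 : 2 ≤ N) {x y z : R} (hx : x ∈ I.toFun 1) (hy : y ∈ I.toFun 1)
    (hz : z ∈ I.toFun 1) :
    starTrunc (bernCoeff K) N (starTrunc (bernCoeff K) N x y) z =
      starTrunc (bernCoeff K) N x (starTrunc (bernCoeff K) N y z) := by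
  have hxy : starTrunc (bernCoeff K) N x y ∈ I.toFun 1 := starTrunc_mem I.toLie _ N hx hy
  have hyz : starTrunc (bernCoeff K) N y z ∈ I.toFun 1 := starTrunc_mem I.toLie _ N hy hz
  rw [starTrunc_eq_truncLog I hN hN2 hxy hz, starTrunc_eq_truncLog I hN hN2 hx hyz,
    truncExp_starTrunc I hN hN2 hx hy, truncExp_starTrunc I hN hN2 hy hz, mul_assoc]

/-- The congruence modulo a step of a filtration. -/
def RingFiltration.ringCon (I : RingFiltration K R) (N : ℕ) : RingCon R where
  r a b := a - b ∈ I.toFun N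
  iseqv := by
    refine ⟨fun a => by simp, fun {a b} h => ?_, fun {a b c} h h' => ?_⟩
    · rw [← neg_sub]; exact Submodule.neg_mem _ h
    · rw [← sub_add_sub_cancel a b c]; exact Submodule.add_mem _ h h'
  add' {a b c d} h h' := by
    rw [add_sub_add_comm]; exact Submodule.add_mem _ h h'
  mul' {a b c d} h h' := by
    have h1 := I.mul_mem (I.mem_zero a) h'
    have h2 := I.mul_mem h (I.mem_zero d)
    rw [zero_add] at h1
    rw [add_zero] at h2
    have := Submodule.add_mem _ h1 h2
    rwa [mul_sub, sub_mul, sub_add_sub_cancel] at this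

/-- The filtration of the quotient by a step of a filtration. -/
def RingFiltration.quotient (I : RingFiltration K R) (N : ℕ) :
    RingFiltration K (I.ringCon N).Quotient where
  toFun n := (I.toFun n).map ((I.ringCon N).mkₐ (α := K)).toLinearMap
  anti := fun _ _ h => Submodule.map_mono (I.anti h)
  mem_zero x := by
    obtain ⟨y, rfl⟩ := (I.ringCon N).mkₐ_surjective (α := K) x
    exact ⟨y, I.mem_zero y, rfl⟩
  mul_mem := by
    rintro m n _ _ ⟨x, hx, rfl⟩ ⟨y, hy, rfl⟩
    exact ⟨x * y, I.mul_mem hx hy, map_mul ((I.ringCon N).mkₐ (α := K)) x y⟩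

theorem RingFiltration.mkₐ_eq_iff (I : RingFiltration K R) (N : ℕ) (x y : R) :
    (I.ringCon N).mkₐ (α := K) x = (I.ringCon N).mkₐ (α := K) y ↔ x - y ∈ I.toFun N :=
  (I.ringCon N).eq

theorem RingFiltration.quotient_eq_bot (I : RingFiltration K R) (N : ℕ) :
    (I.quotient N).toFun N = ⊥ := by
  rw [eq_bot_iff]
  rintro _ ⟨x, hx, rfl⟩
  rw [Submodule.mem_bot]
  exact ((I.mkₐ_eq_iff N x 0).mpr (by simpa using hx)).trans (map_zero _)

/-- Truncated products and series commute with algebra maps, so a congruence modulo the `N`-th step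
can be checked in the quotient, where that step is zero. -/
theorem starTrunc_sub_truncLog_mem [CharZero K] (I : RingFiltration K R) {N : ℕ} (hN2 : 2 ≤ N)
    {x y : R} (hx : x ∈ I.toFun 1) (hy : y ∈ I.toFun 1) :
    starTrunc (bernCoeff K) N x y - truncLog K N (truncExp K N x * truncExp K N y - 1) ∈
      I.toFun N := by
  set π := (I.ringCon N).mkₐ (α := K) with hπ
  have hs : ∀ u v : R, π (starTrunc (bernCoeff K) N u v) =
      starTrunc (bernCoeff K) N (π u) (π v) := starTrunc_map π.toLieHom _ N
  rw [← I.mkₐ_eq_iff N, ← hπ, hs, starTrunc_eq_truncLog (I.quotient N) (I.quotient_eq_bot N) hN2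
    (x := π x) (y := π y) (Submodule.mem_map_of_mem hx) (Submodule.mem_map_of_mem hy),
    map_truncLog, map_sub, map_mul, map_one, map_truncExp, map_truncExp]

theorem starTrunc_assoc_sub_mem [CharZero K] (I : RingFiltration K R) {N : ℕ} (hN2 : 2 ≤ N)
    {x y z : R} (hx : x ∈ I.toFun 1) (hy : y ∈ I.toFun 1) (hz : z ∈ I.toFun 1) :
    starTrunc (bernCoeff K) N (starTrunc (bernCoeff K) N x y) z -
      starTrunc (bernCoeff K) N x (starTrunc (bernCoeff K) N y z) ∈ I.toFun N := by
  set π := (I.ringCon N).mkₐ (α := K) with hπ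
  have hs : ∀ u v : R, π (starTrunc (bernCoeff K) N u v) =
      starTrunc (bernCoeff K) N (π u) (π v) := starTrunc_map π.toLieHom _ N
  rw [← I.mkₐ_eq_iff N, ← hπ, hs, hs, hs, hs]
  exact starTrunc_assoc_of_nilpotent (I.quotient N) (I.quotient_eq_bot N) hN2
    (Submodule.mem_map_of_mem hx) (Submodule.mem_map_of_mem hy) (Submodule.mem_map_of_mem hz)

variable (K R) in
/-- The filtration of the power series by the order. -/
def powerSeriesFiltration : RingFiltration K (PowerSeries R) where
  toFun n :=
    { carrier := {p | ∀ i < n, PowerSeries.coeff i p = 0}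
      add_mem' := fun hp hq i hi => by rw [map_add, hp i hi, hq i hi, add_zero]
      zero_mem' := fun i _ => map_zero _
      smul_mem' := fun c p hp i hi => by
        rw [PowerSeries.coeff_smul, hp i hi, smul_zero] }
  anti := fun _ _ h _ hp i hi => hp i (hi.trans_le h)
  mem_zero := fun _ i hi => absurd hi (Nat.not_lt_zero i)
  mul_mem {m n p q} hp hq i hi := by
    rw [PowerSeries.coeff_mul]
    refine Finset.sum_eq_zero fun k hk => ?_
    rw [mem_antidiagonal] at hk
    rcases lt_or_ge k.1 m with h | h
    · rw [hp _ h, zero_mul]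
    · rw [hq _ (by omega), mul_zero]

/-! ### The free Lie algebra -/

variable (K) (X : Type)

/-- The span is a Lie subalgebra containing the generators; by the universal property the identity
factors through it. -/
theorem span_range_Z_of :
    Submodule.span K (Set.range fun T : LTree X => T.Z (FreeLieAlgebra.of K)) = ⊤ := by
  set S := Submodule.span K (Set.range fun T : LTree X => T.Z (FreeLieAlgebra.of K)) with hS
  have hlie : ∀ u v, u ∈ S → v ∈ S → ⁅u, v⁆ ∈ S := by
    intro u v hu hv
    induction hu using Submodule.span_induction with
    | zero => rw [zero_lie]; exact S.zero_mem
    | add a b _ _ ha hb => rw [add_lie]; exact S.add_mem ha hb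
    | smul c a _ ha => rw [smul_lie]; exact S.smul_mem c ha
    | mem a ha =>
      obtain ⟨l, rfl⟩ := ha
      induction hv using Submodule.span_induction with
      | zero => rw [lie_zero]; exact S.zero_mem
      | add a b _ _ ha hb => rw [lie_add]; exact S.add_mem ha hb
      | smul c a _ ha => rw [lie_smul]; exact S.smul_mem c ha
      | mem b hb =>
        obtain ⟨r, rfl⟩ := hb
        exact Submodule.subset_span ⟨LTree.node l r, rfl⟩
  let S' : LieSubalgebra K (FreeLieAlgebra K X) := { S with lie_mem' := fun hu hv => hlie _ _ hu hv }
  let g : FreeLieAlgebra K X →ₗ⁅K⁆ S' := FreeLieAlgebra.lift K fun x =>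
    ⟨FreeLieAlgebra.of K x, Submodule.subset_span ⟨LTree.leaf x, rfl⟩⟩
  have hg : S'.incl.comp g = LieHom.id := by
    apply FreeLieAlgebra.hom_ext
    intro x
    simp [g]
  rw [eq_top_iff]
  intro u _
  have := LieHom.congr_fun hg u
  rw [LieHom.id_apply] at this
  rw [← this]
  exact (g u).2

/-- The action of the free associative algebra on `F × K`, for the free Lie algebra `F`, such that
a generator `x` sends `(f, c)` to `([x, f] + c x, 0)`. -/
noncomputable def freeAction :
    FreeAlgebra K X →ₐ[K] Module.End K (FreeLieAlgebra K X × K) :=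
  FreeAlgebra.lift K fun x =>
    LinearMap.prod
      ((LieAlgebra.ad K _ (FreeLieAlgebra.of K x)).comp (LinearMap.fst K _ K) +
        (LinearMap.toSpanSingleton K _ (FreeLieAlgebra.of K x)).comp (LinearMap.snd K _ K)) 0

/-- A homogeneous element of degree `k` acts by `(f, c) ↦ ([u, f] + k c u, 0)`. -/
theorem freeAction_Z (T : LTree X) (f : FreeLieAlgebra K X) (c : K) :
    freeAction K X (T.Z (FreeAlgebra.ι K)) (f, c) =
      (⁅T.Z (FreeLieAlgebra.of K), f⁆ +
        ((T.leaves.length : K) * c) • T.Z (FreeLieAlgebra.of K), 0) := by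
  induction T generalizing f c with
  | leaf x => simp [freeAction, LTree.Z, LTree.leaves]
  | node l r ihl ihr =>
    simp only [LTree.Z, LieRing.of_associative_ring_bracket, map_sub, map_mul, LinearMap.sub_apply,
      Module.End.mul_apply, ihl, ihr, LTree.leaves, List.length_append, Nat.cast_add]
    rw [Prod.mk_sub_mk, sub_zero]
    congr 1
    simp only [mul_zero, zero_smul, add_zero, lie_add, lie_smul, lie_lie, add_mul, add_smul]
    rw [← lie_skew (r.Z _) (l.Z _), smul_neg]
    abel

/-- Dynkin-Specht-Wever argument: letting the relation act on `(0, 1)` through `freeAction` returns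
`k` times the same combination in the free Lie algebra, and `k` is invertible. This gives
injectivity into the free associative algebra degree by degree. -/
theorem ι_homogeneous_eq_zero [CharZero K] {k : ℕ} (hk : 0 < k) (s : Finset (LTree X))
    (hs : ∀ T ∈ s, T.leaves.length = k) (c : LTree X → K)
    (h : ∑ T ∈ s, c T • T.Z (FreeAlgebra.ι K) = 0) :
    ∑ T ∈ s, c T • T.Z (FreeLieAlgebra.of K) = 0 := by
  have h1 := congrArg (fun u => (freeAction K X u (0, 1)).1) h
  simp only [map_sum, map_smul, LinearMap.sum_apply, LinearMap.smul_apply, freeAction_Z, lie_zero,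
    zero_add, mul_one, map_zero, LinearMap.zero_apply, Prod.fst_zero, Prod.fst_sum,
    Prod.smul_fst] at h1
  have h2 : ∑ T ∈ s, c T • (T.leaves.length : K) • T.Z (FreeLieAlgebra.of K) =
      (k : K) • ∑ T ∈ s, c T • T.Z (FreeLieAlgebra.of K) := by
    rw [Finset.smul_sum]
    refine Finset.sum_congr rfl fun T hT => ?_
    rw [hs T hT, smul_comm]
  rw [h2, smul_eq_zero] at h1
  exact h1.resolve_left (Nat.cast_ne_zero.mpr hk.ne')

/-- The homomorphism from the free Lie algebra to the power series over the free associative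
algebra that sends a generator `x` to `x s`. -/
noncomputable def freeGraded : FreeLieAlgebra K X →ₗ⁅K⁆ PowerSeries (FreeAlgebra K X) :=
  FreeLieAlgebra.lift K fun x => PowerSeries.monomial 1 (FreeAlgebra.ι K x)

theorem Z_monomial {A : Type} {R : Type*} [Ring R] (φ : A → R) (T : LTree A) :
    T.Z (fun c => PowerSeries.monomial 1 (φ c)) =
      PowerSeries.monomial T.leaves.length (T.Z φ) := by
  induction T with
  | leaf x => rfl
  | node l r ihl ihr =>
    simp only [LTree.Z, ihl, ihr, LieRing.of_associative_ring_bracket, LTree.leaves,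
      List.length_append, PowerSeries.monomial_mul_monomial, map_sub]
    rw [add_comm r.leaves.length]

theorem freeGraded_Z (T : LTree X) : freeGraded K X (T.Z (FreeLieAlgebra.of K)) =
    PowerSeries.monomial T.leaves.length (T.Z (FreeAlgebra.ι K)) := by
  rw [LTree.Z_map (freeGraded K X) (LieHom.map_lie _), ← Z_monomial]
  congr 1
  ext x
  simp [freeGraded]

/-- Induction on `i`, moving a factor from `u` to `v` by the Jacobi identity. The extra `1` appears
because index `0` stands for `L^1`. -/
theorem lie_mem_lowerCentralSeries {L : Type*} [LieRing L] [LieAlgebra K L] (i j : ℕ) {u v : L}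
    (hu : u ∈ LieModule.lowerCentralSeries K L L i)
    (hv : v ∈ LieModule.lowerCentralSeries K L L j) :
    ⁅u, v⁆ ∈ LieModule.lowerCentralSeries K L L (i + j + 1) := by
  induction i generalizing j u v with
  | zero =>
    rw [zero_add, LieModule.lowerCentralSeries_succ]
    exact LieSubmodule.lie_mem_lie (LieSubmodule.mem_top u) hv
  | succ i ih =>
    rw [LieModule.lowerCentralSeries_succ, ← LieSubmodule.mem_toSubmodule,
      LieSubmodule.lieIdeal_oper_eq_linear_span'] at hu
    induction hu using Submodule.span_induction with
    | zero => rw [zero_lie]; exact zero_mem _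
    | add a b _ _ ha hb => rw [add_lie]; exact add_mem ha hb
    | smul c a _ ha => rw [smul_lie]; exact SMulMemClass.smul_mem c ha
    | mem a ha =>
      obtain ⟨x, -, m, hm, rfl⟩ := ha
      rw [lie_lie]
      refine sub_mem ?_ ?_
      · have := ih j hm hv
        rw [show i + 1 + j + 1 = (i + j + 1) + 1 by omega, LieModule.lowerCentralSeries_succ]
        exact LieSubmodule.lie_mem_lie (LieSubmodule.mem_top x) this
      · have h1 : ⁅x, v⁆ ∈ LieModule.lowerCentralSeries K L L (j + 1) := by
          rw [LieModule.lowerCentralSeries_succ]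
          exact LieSubmodule.lie_mem_lie (LieSubmodule.mem_top x) hv
        have := ih (j + 1) hm h1
        rwa [show i + 1 + j + 1 = i + (j + 1) + 1 by omega]

/-- The filtration by the lower central series: `L^n` in degree `n > 0`. -/
def lcsFiltration (L : Type*) [LieRing L] [LieAlgebra K L] : LieFiltration K L where
  toFun n := (LieModule.lowerCentralSeries K L L (n - 1)).toSubmodule
  anti := fun m n h => LieModule.antitone_lowerCentralSeries K L L (Nat.sub_le_sub_right h 1)
  lie_mem {m n x y} hx hy :=
    LieModule.antitone_lowerCentralSeries K L L (by omega)
      (lie_mem_lowerCentralSeries K _ _ hx hy)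

theorem mem_lcsFiltration_one {L : Type*} [LieRing L] [LieAlgebra K L] (x : L) :
    x ∈ (lcsFiltration K L).toFun 1 := LieSubmodule.mem_top (R := K) (L := L) x

/-- In characteristic zero the free Lie algebra embeds into the free associative algebra,
compatibly with the filtrations. -/
theorem mem_lowerCentralSeries_of_freeGraded [CharZero K] (N : ℕ) (u : FreeLieAlgebra K X)
    (hu : freeGraded K X u ∈ (powerSeriesFiltration K (FreeAlgebra K X)).toFun N) :
    u ∈ (lcsFiltration K (FreeLieAlgebra K X)).toFun N := by
  classical
  have hu' : u ∈ Submodule.span K (Set.range fun T : LTree X => T.Z (FreeLieAlgebra.of K)) := by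
    rw [span_range_Z_of]; trivial
  obtain ⟨c, rfl⟩ := (Finsupp.mem_span_range_iff_exists_finsupp).mp hu'
  rw [Finsupp.sum] at hu ⊢
  -- Brackets with at least `N` leaves lie in the required step; the others are grouped by degree,
  -- and each group vanishes because its image does.
  rw [← Finset.sum_filter_add_sum_filter_not c.support fun T => T.leaves.length < N]
  refine Submodule.add_mem _ ?_ (Submodule.sum_mem _ fun T hT => Submodule.smul_mem _ _ ?_)
  · rw [← Finset.sum_fiberwise_of_maps_to (g := fun T : LTree X => T.leaves.length)
      (t := Finset.range N) (by simp)]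
    refine Submodule.sum_mem _ fun k hk => ?_
    rw [Finset.mem_range] at hk
    rcases Nat.eq_zero_or_pos k with rfl | hpos
    · rw [Finset.filter_filter, Finset.filter_false_of_mem, Finset.sum_empty]
      · exact Submodule.zero_mem _
      · intro T _ h
        exact T.leaves_length_pos.ne' h.2
    · rw [ι_homogeneous_eq_zero K X hpos]
      · exact Submodule.zero_mem _
      · simp
      · have h := hu k hk
        simp only [map_sum, map_smul, freeGraded_Z, PowerSeries.coeff_smul,
          PowerSeries.coeff_monomial, smul_ite, smul_zero] at h
        rw [Finset.filter_filter, Finset.sum_filter]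
        refine Eq.trans (Finset.sum_congr rfl fun T _ => ?_) h
        by_cases hT : T.leaves.length = k
        · simp [hT, hk]
        · simp [hT, Ne.symm hT]
  · have hT' := (Finset.mem_filter.mp hT).2
    exact (lcsFiltration K _).anti (by omega)
      (T.Z_mem (lcsFiltration K _) fun c => mem_lcsFiltration_one K _)

end Associativity

section CompleteLie

variable {K : Type*} [Field K] {L : Type*} [LieRing L] [LieAlgebra K L]

/-! ### Convergence -/

open Classical in
/-- The posetted trees with fewer than `N` leaves. -/
noncomputable def smallBTrees (N : ℕ) : Finset BTrees :=
  (LTree.smallTrees Bool N).subtype LTree.IsPosetted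

theorem mem_smallBTrees {N : ℕ} {T : BTrees} :
    T ∈ smallBTrees N ↔ T.1.leaves.length < N := by
  classical
  exact Finset.mem_subtype.trans LTree.mem_smallTrees

theorem starTerm_mem (I : LieFiltration K L) (a : ℕ → K) {x y : L} (hx : x ∈ I.toFun 1)
    (hy : y ∈ I.toFun 1) (T : BTrees) : starTerm a x y T ∈ I.toFun T.1.leaves.length :=
  Submodule.smul_mem _ _ (LTree.Z_mem I (labelValues_mem hx hy) _)

theorem sum_smallBTrees (a : ℕ → K) (N : ℕ) (x y : L) :
    ∑ T ∈ smallBTrees N, starTerm a x y T = starTrunc a N x y := by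
  classical
  have h1 : ∀ T : BTrees, starTerm a x y T = T.1.wcoeff a • T.1.Z (labelValues x y) := by
    intro T
    rw [starTerm, LTree.wcoeff, if_pos T.2]
  simp only [h1]
  rw [smallBTrees, starTrunc]
  refine (Finset.sum_subtype_eq_sum_filter
    (fun T : LTree Bool => T.wcoeff a • T.Z (labelValues x y))).trans ?_
  rw [Finset.sum_filter]
  refine Finset.sum_congr rfl fun T _ => ?_
  split_ifs with h
  · rfl
  · rw [LTree.wcoeff, if_neg h, zero_smul]

theorem sum_starTerm_sub_mem (I : LieFiltration K L) (a : ℕ → K) {x y : L} (hx : x ∈ I.toFun 1)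
    (hy : y ∈ I.toFun 1) (N : ℕ) {S : Finset BTrees} (hS : smallBTrees N ⊆ S) :
    ∑ T ∈ S, starTerm a x y T - starTrunc a N x y ∈ I.toFun N := by
  classical
  rw [← sum_smallBTrees, ← Finset.sum_sdiff hS, add_sub_cancel_right]
  refine Submodule.sum_mem _ fun T hT => I.anti ?_ (starTerm_mem I a hx hy T)
  rw [Finset.mem_sdiff, mem_smallBTrees] at hT
  omega

theorem starTrunc_sub_starTrunc_mem (I : LieFiltration K L) (a : ℕ → K) {x y : L}
    (hx : x ∈ I.toFun 1) (hy : y ∈ I.toFun 1) {M N : ℕ} (h : N ≤ M) :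
    starTrunc a M x y - starTrunc a N x y ∈ I.toFun N := by
  rw [← sum_smallBTrees a M]
  refine sum_starTerm_sub_mem I a hx hy N fun T hT => ?_
  rw [mem_smallBTrees] at hT ⊢
  omega

/-- `starProd` is defined by choice, so a sum has to be exhibited. Only finitely many trees have
fewer than `N` leaves, and the truncations differ by ever deeper terms; completeness supplies their
limit. -/
theorem LCSComplete.hasSum_starProd (hL : LCSComplete K L) (a : ℕ → K) (x y : L) :
    LCSHasSum K (starTerm a x y) (starProd a x y) := by
  refine Classical.epsilon_spec (p := LCSHasSum K (starTerm a x y)) ?_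
  have hx := mem_lcsFiltration_one K x
  have hy := mem_lcsFiltration_one K y
  obtain ⟨s, hs⟩ := hL.complete (fun n => starTrunc a (n + 1) x y) fun n =>
    starTrunc_sub_starTrunc_mem (lcsFiltration K L) a hx hy (Nat.le_succ (n + 1))
  refine ⟨s, fun n => ⟨smallBTrees (n + 1), fun T hT => ?_⟩⟩
  have h1 := sum_starTerm_sub_mem (lcsFiltration K L) a hx hy (n + 1) hT
  have := add_mem h1 (hs n)
  rwa [sub_add_sub_cancel] at this

theorem LCSComplete.starProd_sub_starTrunc_mem (hL : LCSComplete K L) (a : ℕ → K) (N : ℕ)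
    (x y : L) : starProd a x y - starTrunc a N x y ∈ (lcsFiltration K L).toFun N := by
  classical
  obtain ⟨S, hS⟩ := hL.hasSum_starProd a x y (N - 1)
  have h1 := hS (S ∪ smallBTrees N) Finset.subset_union_left
  have h2 := sum_starTerm_sub_mem (lcsFiltration K L) a (mem_lcsFiltration_one K x)
    (mem_lcsFiltration_one K y) N (Finset.subset_union_right (s₁ := S) (s₂ := smallBTrees N))
  have := sub_mem h2 h1
  rwa [sub_sub_sub_cancel_left] at this

theorem lie_mem_lcsFiltration (N : ℕ) (u : L) :
    ∀ v ∈ (lcsFiltration K L).toFun N, ⁅u, v⁆ ∈ (lcsFiltration K L).toFun N :=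
  fun _ hv => LieSubmodule.lie_mem _ hv

/-- Inner and outer products can both be truncated, because `starTrunc` respects congruences modulo
an ideal. Associativity thus becomes a question about finite sums. -/
theorem LCSComplete.starProd_starProd_sub_mem (hL : LCSComplete K L) (a : ℕ → K) (N : ℕ)
    (x y z : L) :
    (starProd a (starProd a x y) z - starProd a x (starProd a y z)) -
      (starTrunc a N (starTrunc a N x y) z - starTrunc a N x (starTrunc a N y z)) ∈
        (lcsFiltration K L).toFun N := by
  have h1 := add_mem (hL.starProd_sub_starTrunc_mem a N (starProd a x y) z)
    (starTrunc_sub_mem _ (lie_mem_lcsFiltration N) a N (hL.starProd_sub_starTrunc_mem a N x y)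
      (show z - z ∈ _ by rw [sub_self]; exact zero_mem _))
  have h2 := add_mem (hL.starProd_sub_starTrunc_mem a N x (starProd a y z))
    (starTrunc_sub_mem _ (lie_mem_lcsFiltration N) a N
      (show x - x ∈ _ by rw [sub_self]; exact zero_mem _)
      (hL.starProd_sub_starTrunc_mem a N y z))
  rw [sub_add_sub_cancel] at h1 h2
  have := sub_mem h1 h2
  rwa [sub_sub_sub_comm] at this

theorem LCSComplete.starProd_assoc (hL : LCSComplete K L) (a : ℕ → K) (x y z : L)
    (h : ∀ N, 2 ≤ N → starTrunc a N (starTrunc a N x y) z - starTrunc a N x (starTrunc a N y z) ∈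
      (lcsFiltration K L).toFun N) :
    starProd a (starProd a x y) z = starProd a x (starProd a y z) := by
  refine sub_eq_zero.mp (hL.separated _ fun n => ?_)
  have h1 := add_mem (hL.starProd_starProd_sub_mem a (n + 2) x y z) (h (n + 2) (by omega))
  rw [sub_add_cancel] at h1
  exact (lcsFiltration K L).anti (show n + 1 ≤ n + 2 by omega) h1

/-! ### The product for the coefficients `h^n b_n` -/

/-- The preimage of `J.toFun 1` is a subalgebra containing the generators, hence everything; each
further bracket then raises the degree by one. -/
theorem map_mem_of_mem_lcsFiltration {X : Type*} (J : LieFiltration K L)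
    (φ : FreeLieAlgebra K X →ₗ⁅K⁆ L) (hφ : ∀ x, φ (FreeLieAlgebra.of K x) ∈ J.toFun 1) {N : ℕ}
    (hN : 0 < N) {u : FreeLieAlgebra K X} (hu : u ∈ (lcsFiltration K _).toFun N) :
    φ u ∈ J.toFun N := by
  let S : LieSubalgebra K (FreeLieAlgebra K X) :=
    { (J.toFun 1).comap (φ : FreeLieAlgebra K X →ₗ[K] L) with
      lie_mem' := fun {u v} hu hv => by
        have := J.anti (show 1 ≤ 1 + 1 by omega) (J.lie_mem hu hv)
        change φ ⁅u, v⁆ ∈ J.toFun 1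
        rwa [LieHom.map_lie] }
  let g : FreeLieAlgebra K X →ₗ⁅K⁆ S :=
    FreeLieAlgebra.lift K fun x => ⟨FreeLieAlgebra.of K x, hφ x⟩
  have hg : S.incl.comp g = LieHom.id := by
    apply FreeLieAlgebra.hom_ext
    intro x
    simp [g]
  have h1 : ∀ u, φ u ∈ J.toFun 1 := by
    intro u
    have := LieHom.congr_fun hg u
    rw [LieHom.id_apply] at this
    rw [← this]
    exact (g u).2
  obtain ⟨n, rfl⟩ : ∃ n, N = n + 1 := ⟨N - 1, by omega⟩
  change u ∈ LieModule.lowerCentralSeries K (FreeLieAlgebra K X) (FreeLieAlgebra K X) n at hu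
  clear hN hg g S
  induction n generalizing u with
  | zero => exact h1 u
  | succ n ih =>
    rw [LieModule.lowerCentralSeries_succ, ← LieSubmodule.mem_toSubmodule,
      LieSubmodule.lieIdeal_oper_eq_linear_span'] at hu
    induction hu using Submodule.span_induction with
    | zero => rw [map_zero]; exact zero_mem _
    | add a b _ _ ha hb => rw [map_add]; exact add_mem ha hb
    | smul c a _ ha => rw [map_smul]; exact SMulMemClass.smul_mem c ha
    | mem a ha =>
      obtain ⟨x, -, m, hm, rfl⟩ := ha
      rw [LieHom.map_lie, add_comm (n + 1)]
      exact J.lie_mem (h1 x) (ih hm)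

-- It suffices to treat three free generators. Giving them degree one in power series over the free
-- associative algebra reduces the claim to the filtered associative case; substituting `x, y, z`
-- carries it to `L`.
attribute [local instance 100] LieRing.ofAssociativeRing in
theorem starTrunc_bernCoeff_assoc [CharZero K] {N : ℕ} (hN2 : 2 ≤ N) (x y z : L) :
    starTrunc (bernCoeff K) N (starTrunc (bernCoeff K) N x y) z -
      starTrunc (bernCoeff K) N x (starTrunc (bernCoeff K) N y z) ∈
        (lcsFiltration K L).toFun N := by
  let φ : FreeLieAlgebra K (Fin 3) →ₗ⁅K⁆ L := FreeLieAlgebra.lift K ![x, y, z]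
  let e : Fin 3 → FreeLieAlgebra K (Fin 3) := FreeLieAlgebra.of K
  have he : ∀ i, freeGraded K (Fin 3) (e i) ∈
      (powerSeriesFiltration K (FreeAlgebra K (Fin 3))).toFun 1 := by
    intro i n hn
    simp only [freeGraded, e, FreeLieAlgebra.lift_of_apply, PowerSeries.coeff_monomial]
    rw [if_neg (by omega)]
  have h1 := starTrunc_assoc_sub_mem (powerSeriesFiltration K (FreeAlgebra K (Fin 3))) hN2
    (he 0) (he 1) (he 2)
  rw [← starTrunc_map, ← starTrunc_map, ← starTrunc_map, ← starTrunc_map, ← map_sub] at h1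
  have h2 := mem_lowerCentralSeries_of_freeGraded K (Fin 3) N _ h1
  have h4 := map_mem_of_mem_lcsFiltration (lcsFiltration K L) φ
    (fun i => mem_lcsFiltration_one K _) (by omega) h2
  have h5 : φ (e 0) = x ∧ φ (e 1) = y ∧ φ (e 2) = z := by
    simp [φ, e]
  rwa [map_sub, starTrunc_map, starTrunc_map, starTrunc_map, starTrunc_map, h5.1, h5.2.1,
    h5.2.2] at h4

theorem LTree.d_pos_of_mem_subroots {A : Type} (T : LTree A) :
    (∀ v ∈ T.rootIfInternal, 0 < v.d) ∧ ∀ v ∈ T.properSubroots, 0 < v.d := by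
  induction T with
  | leaf x => simp [LTree.rootIfInternal, LTree.properSubroots]
  | node l r ihl ihr =>
    simp only [LTree.rootIfInternal, LTree.properSubroots, List.forall_mem_append,
      List.forall_mem_singleton]
    exact ⟨Nat.succ_pos _, ihl, ihr.2⟩

/-- Subroots are internal vertices, so `a 0` never enters. -/
theorem starTerm_congr {a a' : ℕ → K} (h : ∀ n, 0 < n → a n = a' n) (x y : L) :
    starTerm a x y = starTerm a' x y := by
  ext T
  rw [starTerm, starTerm, LTree.coeff, LTree.coeff]
  congr 2
  refine List.map_congr_left fun v hv => ?_
  rw [h v.d]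
  rcases List.mem_append.mp hv with hv | hv
  · exact T.1.d_pos_of_mem_subroots.1 v hv
  · exact T.1.d_pos_of_mem_subroots.2 v hv

theorem starProd_congr {a a' : ℕ → K} (h : ∀ n, 0 < n → a n = a' n) (x y : L) :
    starProd a x y = starProd a' x y := by
  rw [starProd, starProd, starTerm_congr h]

/-- By `smul_starTrunc`, multiplication by `h` carries this product to the one for `bernCoeff`;
dividing by `h` afterwards requires `h ≠ 0`. -/
theorem starTrunc_pow_mul_bernCoeff_assoc [CharZero K] {h : K} (hh : h ≠ 0) {N : ℕ}
    (hN2 : 2 ≤ N) (x y z : L) :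
    let a := fun n => h ^ n * bernCoeff K n
    starTrunc a N (starTrunc a N x y) z - starTrunc a N x (starTrunc a N y z) ∈
      (lcsFiltration K L).toFun N := by
  have h1 := starTrunc_bernCoeff_assoc (K := K) hN2 (h • x) (h • y) (h • z)
  rw [← smul_starTrunc, ← smul_starTrunc, ← smul_starTrunc, ← smul_starTrunc, ← smul_sub]
    at h1
  exact (Submodule.smul_mem_iff _ hh).mp h1

theorem starTrunc_of_eq_zero {a : ℕ → K} (ha : ∀ n, 0 < n → a n = 0) {N : ℕ} (hN2 : 2 ≤ N)
    (x y : L) : starTrunc a N x y = x + y := by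
  refine starTrunc_of_node_eq_zero a hN2 x y fun l r => ?_
  have : (LTree.node l r).wcoeff a = 0 := by
    have hs : (LTree.node l r).subroots = LTree.node l r :: (LTree.node l r).properSubroots := rfl
    have : a (LTree.node l r).d = 0 := ha _ (Nat.succ_pos _)
    simp [LTree.wcoeff, LTree.coeff, hs, this]
  rw [this, zero_smul]

theorem LCSComplete.starProd_bernCoeff_assoc [CharZero K] (hL : LCSComplete K L) {a : ℕ → K} {h : K}
    (ha : ∀ n, 0 < n → a n = h ^ n * bernCoeff K n) (x y z : L) :
    starProd a (starProd a x y) z = starProd a x (starProd a y z) := by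
  simp only [starProd_congr ha]
  refine hL.starProd_assoc _ x y z fun N hN2 => ?_
  rcases eq_or_ne h 0 with rfl | hh
  · have h0 : ∀ n, 0 < n → (0 : K) ^ n * bernCoeff K n = 0 := fun n hn => by
      rw [zero_pow hn.ne', zero_mul]
    simp only [starTrunc_of_eq_zero h0 hN2, add_assoc, sub_self]
    exact zero_mem _
  · exact starTrunc_pow_mul_bernCoeff_assoc hh hN2 x y z

/-! ### The Baker-Campbell-Hausdorff product -/

/-- The component with `n` leaves of `X ∗ Y` in the free Lie algebra. -/
noncomputable def freeStarComponent (K : Type*) [Field K] (n : ℕ) : FreeLieAlgebra K Bool :=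
  open Classical in ∑ T ∈ LTree.smallTrees Bool (n + 1) with T.leaves.length = n,
    T.wcoeff (bernCoeff K) • T.Z (FreeLieAlgebra.of K)

theorem lift_freeStarComponent (φ : Bool → L) (n : ℕ) :
    FreeLieAlgebra.lift K φ (freeStarComponent K n) =
      open Classical in ∑ T ∈ LTree.smallTrees Bool (n + 1) with T.leaves.length = n,
        T.wcoeff (bernCoeff K) • T.Z φ := by
  rw [freeStarComponent, map_sum]
  refine Finset.sum_congr rfl fun T _ => ?_
  rw [map_smul, LTree.Z_map _ (LieHom.map_lie _)]
  simp only [FreeLieAlgebra.lift_of_apply]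

theorem sum_lift_freeStarComponent (x y : L) (N : ℕ) :
    ∑ n ∈ Finset.range N, FreeLieAlgebra.lift K (labelValues x y) (freeStarComponent K n) =
      starTrunc (bernCoeff K) N x y := by
  classical
  rw [starTrunc, ← Finset.sum_fiberwise_of_maps_to (g := fun T : LTree Bool => T.leaves.length)
    (t := Finset.range N) (by simp)]
  refine Finset.sum_congr rfl fun n hn => ?_
  rw [lift_freeStarComponent]
  refine Finset.sum_congr ?_ fun _ _ => rfl
  ext T
  simp only [Finset.mem_filter, LTree.mem_smallTrees, Finset.mem_range] at hn ⊢
  constructor <;> rintro ⟨h1, h2⟩ <;> exact ⟨by omega, h2⟩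

theorem lift_freeStarComponent_mem (I : LieFiltration K L) {x y : L} (hx : x ∈ I.toFun 1)
    (hy : y ∈ I.toFun 1) (n : ℕ) :
    FreeLieAlgebra.lift K (labelValues x y) (freeStarComponent K n) ∈ I.toFun n := by
  classical
  rw [lift_freeStarComponent]
  refine Submodule.sum_mem _ fun T hT => Submodule.smul_mem _ _ ?_
  have := T.Z_mem I (labelValues_mem hx hy)
  rwa [(Finset.mem_filter.mp hT).2] at this

section Free

attribute [local instance 100] LieRing.ofAssociativeRing

theorem truncLog_sub_truncLog_mem {R : Type*} [Ring R] [Algebra K R] {p q : PowerSeries R} {n : ℕ}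
    (h : p - q ∈ (powerSeriesFiltration K R).toFun (n + 1)) (N : ℕ) :
    truncLog K N p - truncLog K N q ∈ (powerSeriesFiltration K R).toFun (n + 1) := by
  set I := powerSeriesFiltration K R
  rw [← I.mkₐ_eq_iff, map_truncLog, map_truncLog]
  congr 1
  exact (I.mkₐ_eq_iff _ _ _).mpr h

theorem genExp_sub_truncExp_mem (c : Bool) (n : ℕ) :
    genExp K c - truncExp K n (PowerSeries.monomial 1 (FreeAlgebra.ι K c)) ∈
      (powerSeriesFiltration K (FreeAlgebra K Bool)).toFun n := by
  intro i hi
  rw [map_sub, genExp, PowerSeries.coeff_mk, truncExp, map_sum]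
  have hpow : ∀ k, (PowerSeries.monomial 1 (FreeAlgebra.ι K c)) ^ k =
      PowerSeries.monomial k (FreeAlgebra.ι K c ^ k) := by
    intro k
    induction k with
    | zero => simp
    | succ k ih => rw [pow_succ, ih, PowerSeries.monomial_mul_monomial, pow_succ]
  simp only [PowerSeries.coeff_smul, hpow, PowerSeries.coeff_monomial, smul_ite, smul_zero]
  rw [Finset.sum_ite_eq, if_pos (Finset.mem_range.mpr hi), sub_self]

/-- With generators of degree one, the coefficient of `s^n` in `starTrunc_sub_truncLog_mem` at level
`n + 1` is the claim; replacing the full exponentials by their truncations does not affect it. -/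
theorem isBCHSeries_freeStarComponent [CharZero K] : IsBCHSeries K (freeStarComponent K) := by
  classical
  intro n
  rcases Nat.eq_zero_or_pos n with rfl | hn
  · rw [lift_freeStarComponent]
    simp only [logTerm, Finset.Icc_eq_empty_of_lt zero_lt_one, Finset.sum_empty]
    refine Finset.sum_eq_zero fun T hT => ?_
    exact absurd (Finset.mem_filter.mp hT).2 T.leaves_length_pos.ne'
  set R := FreeAlgebra K Bool
  set I := powerSeriesFiltration K R with hI
  set x : PowerSeries R := PowerSeries.monomial 1 (FreeAlgebra.ι K true) with hx
  set y : PowerSeries R := PowerSeries.monomial 1 (FreeAlgebra.ι K false) with hy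
  have hmem : ∀ c : Bool, PowerSeries.monomial 1 (FreeAlgebra.ι K c) ∈ I.toFun 1 := by
    intro c m hm
    rw [PowerSeries.coeff_monomial, if_neg (by omega)]
  have h1 := starTrunc_sub_truncLog_mem I (N := n + 1) (by omega) (hmem true) (hmem false)
  have h2 : truncLog K (n + 1) (truncExp K (n + 1) x * truncExp K (n + 1) y - 1) -
      truncLog K (n + 1) (genExp K true * genExp K false - 1) ∈ I.toFun (n + 1) := by
    refine truncLog_sub_truncLog_mem ?_ _
    rw [sub_sub_sub_cancel_right]
    have e1 := (I.mkₐ_eq_iff _ _ _).mpr (genExp_sub_truncExp_mem (K := K) true (n + 1))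
    have e2 := (I.mkₐ_eq_iff _ _ _).mpr (genExp_sub_truncExp_mem (K := K) false (n + 1))
    rw [← I.mkₐ_eq_iff, map_mul, map_mul, e1, e2]
  have h3 := (add_mem h1 h2) n (Nat.lt_succ_self n)
  rw [sub_add_sub_cancel, map_sub, sub_eq_zero] at h3
  have h4 : PowerSeries.coeff n (truncLog K (n + 1) (genExp K true * genExp K false - 1)) =
      logTerm K n := by
    rw [truncLog, logTerm, map_sum]
    simp only [PowerSeries.coeff_smul]
    rfl
  rw [← h4, ← h3, lift_freeStarComponent, starTrunc, map_sum, Finset.sum_filter]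
  refine Finset.sum_congr rfl fun T _ => ?_
  have h5 : labelValues (PowerSeries.monomial 1 (FreeAlgebra.ι K true) : PowerSeries R)
      (PowerSeries.monomial 1 (FreeAlgebra.ι K false)) =
        fun c => PowerSeries.monomial 1 (FreeAlgebra.ι K c) := by
    ext1 c; cases c <;> rfl
  rw [h5, Z_monomial, PowerSeries.coeff_smul, PowerSeries.coeff_monomial]
  by_cases hT : T.leaves.length = n
  · simp [hT]
  · simp [hT, Ne.symm hT]

end Free

theorem LCSComplete.isBCHProduct_starProd [CharZero K] (hL : LCSComplete K L) {a : ℕ → K} {h : K}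
    (ha : ∀ n, 0 < n → a n = h ^ n * bernCoeff K n) (x y : L) :
    IsBCHProduct K (h • x) (h • y) (h • starProd a x y) := by
  refine ⟨freeStarComponent K, isBCHSeries_freeStarComponent, fun n => ?_⟩
  refine ⟨Finset.range (n + 1), fun T hT => ?_⟩
  have h1 : ∑ m ∈ T, FreeLieAlgebra.lift K (labelValues (h • x) (h • y)) (freeStarComponent K m) -
      starTrunc (bernCoeff K) (n + 1) (h • x) (h • y) ∈ (lcsFiltration K L).toFun (n + 1) := by
    rw [← sum_lift_freeStarComponent, ← Finset.sum_sdiff hT, add_sub_cancel_right]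
    refine Submodule.sum_mem _ fun m hm => (lcsFiltration K L).anti ?_
      (lift_freeStarComponent_mem _ (mem_lcsFiltration_one K _) (mem_lcsFiltration_one K _) m)
    simpa using (Finset.mem_sdiff.mp hm).2
  have h2 := Submodule.smul_mem _ h (hL.starProd_sub_starTrunc_mem
    (fun n => h ^ n * bernCoeff K n) (n + 1) x y)
  rw [smul_sub, smul_starTrunc, ← starProd_congr ha] at h2
  have := sub_mem h1 h2
  rwa [sub_sub_sub_cancel_right] at this

end CompleteLie

section Converse

variable {K : Type*} [Field K]

/-! ### From associativity to an identity in all filtered Lie algebras -/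

theorem lcsComplete_of_lowerCentralSeries_eq_bot {L : Type*} [LieRing L] [LieAlgebra K L] {n : ℕ}
    (hn : LieModule.lowerCentralSeries K L L n = ⊥) : LCSComplete K L where
  separated x hx := by
    have := hx n
    rwa [hn, LieSubmodule.mem_bot] at this
  complete u hu := by
    have h1 : ∀ m k, u (m + k) - u m ∈ LieModule.lowerCentralSeries K L L m := by
      intro m k
      induction k with
      | zero => simp
      | succ k ih =>
        have := add_mem (LieModule.antitone_lowerCentralSeries K L L (Nat.le_add_right m k)
          (hu (m + k))) ih
        rwa [sub_add_sub_cancel] at this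
    -- The sequence is constant from index `n` on.
    refine ⟨u n, fun m => ?_⟩
    rcases le_total m n with h | h
    · obtain ⟨k, rfl⟩ := Nat.exists_eq_add_of_le h
      rw [← neg_sub]
      exact neg_mem (h1 m k)
    · obtain ⟨k, rfl⟩ := Nat.exists_eq_add_of_le h
      have := h1 n k
      rw [hn, LieSubmodule.mem_bot] at this
      rw [this]
      exact zero_mem _

/-- The quotient map by a Lie ideal. -/
def lieQuotientMap {L : Type*} [LieRing L] [LieAlgebra K L] (I : LieIdeal K L) : L →ₗ⁅K⁆ L ⧸ I :=
  { (LieSubmodule.Quotient.mk' I : L →ₗ[K] L ⧸ I) with map_lie' := fun {_ _} => rfl }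

theorem lieQuotientMap_eq_zero_iff {L : Type*} [LieRing L] [LieAlgebra K L] {I : LieIdeal K L}
    {u : L} : lieQuotientMap I u = 0 ↔ u ∈ I :=
  LieSubmodule.Quotient.mk_eq_zero'

theorem lowerCentralSeries_quotient_eq_bot (L : Type*) [LieRing L] [LieAlgebra K L] (n : ℕ) :
    LieModule.lowerCentralSeries K (L ⧸ LieModule.lowerCentralSeries K L L n)
      (L ⧸ LieModule.lowerCentralSeries K L L n) n = ⊥ := by
  set I := LieModule.lowerCentralSeries K L L n with hI
  have hsurj : Function.Surjective (lieQuotientMap I) := LieSubmodule.Quotient.surjective_mk' I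
  have h := Function.Surjective.lieModule_lcs_map_eq (R := K) (f := lieQuotientMap I)
    (g := (lieQuotientMap I : L →ₗ[K] L ⧸ I))
    (fun x m => (LieHom.map_lie (lieQuotientMap I) x m).symm) hsurj hsurj n
  rw [← LieSubmodule.toSubmodule_inj, ← h, LieSubmodule.bot_toSubmodule, eq_bot_iff]
  rintro _ ⟨u, hu, rfl⟩
  exact (Submodule.mem_bot K).mpr (lieQuotientMap_eq_zero_iff.mpr hu)

/-- Associativity is assumed only in complete algebras, so it is applied to the nilpotent quotient
of a free Lie algebra. The resulting congruence between finite sums maps to any filtered algebra,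
complete or not. -/
theorem starTrunc_assoc_of_starAssociative {K : Type u} [Field K] {a : ℕ → K}
    (ha : StarAssociative.{u, v} a) {M : Type*} [LieRing M] [LieAlgebra K M]
    (J : LieFiltration K M) {x y z : M} (hx : x ∈ J.toFun 1) (hy : y ∈ J.toFun 1)
    (hz : z ∈ J.toFun 1) {N : ℕ} (hN : 0 < N) :
    starTrunc a N (starTrunc a N x y) z - starTrunc a N x (starTrunc a N y z) ∈ J.toFun N := by
  -- The lift places `F` in the universe over which associativity quantifies.
  let F := FreeLieAlgebra K (ULift.{v} (Fin 3))
  let e : Fin 3 → F := fun i => FreeLieAlgebra.of K ⟨i⟩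
  let φ : F →ₗ⁅K⁆ M := FreeLieAlgebra.lift K fun i => ![x, y, z] i.down
  set D := starTrunc a N (starTrunc a N (e 0) (e 1)) (e 2) -
    starTrunc a N (e 0) (starTrunc a N (e 1) (e 2)) with hD
  have h5 : φ (e 0) = x ∧ φ (e 1) = y ∧ φ (e 2) = z :=
    ⟨FreeLieAlgebra.lift_of_apply _ _, FreeLieAlgebra.lift_of_apply _ _,
      FreeLieAlgebra.lift_of_apply _ _⟩
  suffices h : D ∈ (lcsFiltration K F).toFun N by
    have h4 := map_mem_of_mem_lcsFiltration J φ (fun i => by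
      rw [FreeLieAlgebra.lift_of_apply]
      rcases i with ⟨i⟩
      fin_cases i <;> assumption) hN h
    rwa [hD, map_sub, starTrunc_map, starTrunc_map, starTrunc_map, starTrunc_map, h5.1, h5.2.1,
      h5.2.2] at h4
  set I := LieModule.lowerCentralSeries K F F (N - 1) with hI
  have hbot := lowerCentralSeries_quotient_eq_bot (K := K) F (N - 1)
  have hL : LCSComplete K (F ⧸ I) := lcsComplete_of_lowerCentralSeries_eq_bot hbot
  set π := lieQuotientMap I
  have h1 := hL.starProd_starProd_sub_mem a N (π (e 0)) (π (e 1)) (π (e 2))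
  rw [sub_eq_zero.mpr (ha (F ⧸ I) hL _ _ _), zero_sub, ← starTrunc_map, ← starTrunc_map,
    ← starTrunc_map, ← starTrunc_map, ← map_sub] at h1
  have h2 : -π D ∈ LieModule.lowerCentralSeries K (F ⧸ I) (F ⧸ I) (N - 1) := h1
  rw [hbot, LieSubmodule.mem_bot, neg_eq_zero] at h2
  exact lieQuotientMap_eq_zero_iff.mp h2

theorem starTrunc_two {L : Type*} [LieRing L] [LieAlgebra K L] (a : ℕ → K) (x y : L) :
    starTrunc a 2 x y = x + y := by
  classical
  have : LTree.smallTrees Bool 2 = {LTree.leaf true, LTree.leaf false} := by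
    ext T
    rcases T with ((_ | _) | ⟨l, r⟩)
    · simp [LTree.leaves]
    · simp [LTree.leaves]
    · have hl := l.leaves_length_pos
      have hr := r.leaves_length_pos
      simp only [LTree.mem_smallTrees, LTree.leaves, List.length_append, Finset.mem_insert,
        Finset.mem_singleton, reduceCtorEq, or_self, iff_false]
      omega
  rw [starTrunc, this, Finset.sum_pair (by simp)]
  simp [LTree.Z, labelValues]

/-! ### The test algebra -/

open Polynomial

/-- The semidirect product of the abelian Lie algebra with basis `y, z` and the module
`K[z] ⊕ y K[z]`, where `y` acts with square zero. -/
def TestLie (K : Type*) [Field K] : Type _ := (K × K) × (K[X] × K[X])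

namespace TestLie

noncomputable instance : AddCommGroup (TestLie K) :=
  inferInstanceAs (AddCommGroup ((K × K) × (K[X] × K[X])))

noncomputable instance : Module K (TestLie K) :=
  inferInstanceAs (Module K ((K × K) × (K[X] × K[X])))

/-- The element with the given coordinates. -/
def mk (α β : K) (p q : K[X]) : TestLie K := ((α, β), (p, q))

/-- The coordinates. -/
def cy (u : TestLie K) : K := u.1.1
def cz (u : TestLie K) : K := u.1.2
def c0 (u : TestLie K) : K[X] := u.2.1
def c1 (u : TestLie K) : K[X] := u.2.2

@[ext]
theorem ext {u v : TestLie K} (h1 : u.cy = v.cy) (h2 : u.cz = v.cz) (h3 : u.c0 = v.c0)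
    (h4 : u.c1 = v.c1) : u = v :=
  Prod.ext (Prod.ext h1 h2) (Prod.ext h3 h4)

variable (u v : TestLie K) (c : K)

@[simp] theorem cy_mk (α β : K) (p q : K[X]) : (mk α β p q).cy = α := rfl
@[simp] theorem cz_mk (α β : K) (p q : K[X]) : (mk α β p q).cz = β := rfl
@[simp] theorem c0_mk (α β : K) (p q : K[X]) : (mk α β p q).c0 = p := rfl
@[simp] theorem c1_mk (α β : K) (p q : K[X]) : (mk α β p q).c1 = q := rfl
@[simp] theorem cy_add : (u + v).cy = u.cy + v.cy := rfl
@[simp] theorem cz_add : (u + v).cz = u.cz + v.cz := rfl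
@[simp] theorem c0_add : (u + v).c0 = u.c0 + v.c0 := rfl
@[simp] theorem c1_add : (u + v).c1 = u.c1 + v.c1 := rfl
@[simp] theorem cy_sub : (u - v).cy = u.cy - v.cy := rfl
@[simp] theorem cz_sub : (u - v).cz = u.cz - v.cz := rfl
@[simp] theorem c0_sub : (u - v).c0 = u.c0 - v.c0 := rfl
@[simp] theorem c1_sub : (u - v).c1 = u.c1 - v.c1 := rfl
@[simp] theorem cy_smul : (c • u).cy = c * u.cy := rfl
@[simp] theorem cz_smul : (c • u).cz = c * u.cz := rfl
@[simp] theorem c0_smul : (c • u).c0 = c • u.c0 := rfl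
@[simp] theorem c1_smul : (c • u).c1 = c • u.c1 := rfl
@[simp] theorem cy_zero : (0 : TestLie K).cy = 0 := rfl
@[simp] theorem cz_zero : (0 : TestLie K).cz = 0 := rfl
@[simp] theorem c0_zero : (0 : TestLie K).c0 = 0 := rfl
@[simp] theorem c1_zero : (0 : TestLie K).c1 = 0 := rfl

theorem c0_sum {ι : Type*} (s : Finset ι) (f : ι → TestLie K) :
    (∑ i ∈ s, f i).c0 = ∑ i ∈ s, (f i).c0 :=
  map_sum (⟨⟨c0, c0_zero⟩, c0_add⟩ : TestLie K →+ K[X]) f s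

theorem c1_sum {ι : Type*} (s : Finset ι) (f : ι → TestLie K) :
    (∑ i ∈ s, f i).c1 = ∑ i ∈ s, (f i).c1 :=
  map_sum (⟨⟨c1, c1_zero⟩, c1_add⟩ : TestLie K →+ K[X]) f s

noncomputable instance : Bracket (TestLie K) (TestLie K) where
  bracket u v := mk 0 0 (u.cz • (X * v.c0) - v.cz • (X * u.c0))
    (u.cz • (X * v.c1) - v.cz • (X * u.c1) + u.cy • v.c0 - v.cy • u.c0)

@[simp] theorem cy_lie : ⁅u, v⁆.cy = 0 := rfl
@[simp] theorem cz_lie : ⁅u, v⁆.cz = 0 := rfl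
@[simp] theorem c0_lie : ⁅u, v⁆.c0 = u.cz • (X * v.c0) - v.cz • (X * u.c0) := rfl
@[simp] theorem c1_lie : ⁅u, v⁆.c1 =
    u.cz • (X * v.c1) - v.cz • (X * u.c1) + u.cy • v.c0 - v.cy • u.c0 := rfl

noncomputable instance : LieRing (TestLie K) where
  add_lie u v w := by ext1 <;> simp [mul_add, add_smul] <;> abel
  lie_add u v w := by ext1 <;> simp [mul_add, add_smul] <;> abel
  lie_self u := by ext1 <;> simp
  leibniz_lie u v w := by
    ext1 <;> simp [smul_eq_C_mul] <;> ring

noncomputable instance : LieAlgebra K (TestLie K) where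
  lie_smul c u v := by ext1 <;> simp [smul_eq_C_mul] <;> ring

/-- Used with `l = 1` for `z`, which acts as multiplication by `X`, and with `l = 0` for `y`, which
only moves `c0` to `c1`. -/
theorem dvd_aux {m n k l : ℕ} {β : K} {p : K[X]} (hβ : 1 < m → β = 0) (hp : X ^ n ∣ p)
    (h : m ≤ 1 → k ≤ n + l) : (X : K[X]) ^ k ∣ β • (X ^ l * p) := by
  by_cases hm : 1 < m
  · rw [hβ hm, zero_smul]; exact dvd_zero _
  · refine dvd_smul_of_dvd _ ((pow_dvd_pow X (h (not_lt.mp hm))).trans ?_)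
    rw [add_comm, pow_add]
    exact mul_dvd_mul_left _ hp

/-- The filtration in which `y` and `z` have degree one. -/
noncomputable def filtration : LieFiltration K (TestLie K) where
  toFun n :=
    -- The monomial `X ^ i` has degree `i + 1` in `c0` and `i + 2` in `c1`, the latter because of
    -- the extra bracket with `y`.
    { carrier := {u | ((1 < n → u.cy = 0) ∧ (1 < n → u.cz = 0)) ∧
        X ^ (n - 1) ∣ u.c0 ∧ X ^ (n - 2) ∣ u.c1}
      add_mem' := fun {u v} hu hv =>
        ⟨⟨fun h => by rw [cy_add, hu.1.1 h, hv.1.1 h, add_zero],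
          fun h => by rw [cz_add, hu.1.2 h, hv.1.2 h, add_zero]⟩,
          dvd_add hu.2.1 hv.2.1, dvd_add hu.2.2 hv.2.2⟩
      zero_mem' := ⟨⟨fun _ => rfl, fun _ => rfl⟩, dvd_zero _, dvd_zero _⟩
      smul_mem' := fun c u hu =>
        ⟨⟨fun h => by rw [cy_smul, hu.1.1 h, mul_zero],
          fun h => by rw [cz_smul, hu.1.2 h, mul_zero]⟩,
          dvd_smul_of_dvd _ hu.2.1, dvd_smul_of_dvd _ hu.2.2⟩ }
  anti := fun m n h u hu =>
    ⟨⟨fun h' => hu.1.1 (by omega), fun h' => hu.1.2 (by omega)⟩,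
      (pow_dvd_pow X (by omega)).trans hu.2.1, (pow_dvd_pow X (by omega)).trans hu.2.2⟩
  lie_mem {m n u v} hu hv := by
    refine ⟨⟨fun _ => rfl, fun _ => rfl⟩, ?_, ?_⟩
    · rw [c0_lie]
      have h1 := dvd_aux (k := m + n - 1) (l := 1) hu.1.2 hv.2.1 (by omega)
      have h2 := dvd_aux (k := m + n - 1) (l := 1) hv.1.2 hu.2.1 (by omega)
      rw [pow_one] at h1 h2
      exact dvd_sub h1 h2
    · rw [c1_lie]
      have h1 := dvd_aux (k := m + n - 2) (l := 1) hu.1.2 hv.2.2 (by omega)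
      have h2 := dvd_aux (k := m + n - 2) (l := 1) hv.1.2 hu.2.2 (by omega)
      have h3 := dvd_aux (k := m + n - 2) (l := 0) hu.1.1 hv.2.1 (by omega)
      have h4 := dvd_aux (k := m + n - 2) (l := 0) hv.1.1 hu.2.1 (by omega)
      rw [pow_one] at h1 h2
      rw [pow_zero, one_mul] at h3 h4
      exact dvd_sub (dvd_add (dvd_sub h1 h2) h3) h4

theorem mem_filtration {n : ℕ} {u : TestLie K} : u ∈ filtration.toFun n ↔
    ((1 < n → u.cy = 0) ∧ (1 < n → u.cz = 0)) ∧ X ^ (n - 1) ∣ u.c0 ∧ X ^ (n - 2) ∣ u.c1 :=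
  Iff.rfl

theorem mem_filtration_one (u : TestLie K) : u ∈ filtration.toFun 1 := by
  simp [mem_filtration]

theorem coeff_eq_of_sub_mem {n : ℕ} {u v : TestLie K} (h : u - v ∈ filtration.toFun n) :
    (∀ i, i + 1 < n → u.c0.coeff i = v.c0.coeff i) ∧
      ∀ i, i + 2 < n → u.c1.coeff i = v.c1.coeff i := by
  obtain ⟨-, h0, h1⟩ := h
  rw [X_pow_dvd_iff] at h0 h1
  constructor
  · intro i hi
    have := h0 i (by omega)
    rwa [c0_sub, coeff_sub, sub_eq_zero] at this
  · intro i hi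
    have := h1 i (by omega)
    rwa [c1_sub, coeff_sub, sub_eq_zero] at this

theorem starTrunc_cy_cz (a : ℕ → K) {N : ℕ} (hN : 2 ≤ N) (u v : TestLie K) :
    (starTrunc a N u v).cy = u.cy + v.cy ∧ (starTrunc a N u v).cz = u.cz + v.cz := by
  have h1 := (starTrunc_sub_starTrunc_mem filtration a (mem_filtration_one u)
    (mem_filtration_one v) hN).1
  rw [starTrunc_two] at h1
  exact ⟨sub_eq_zero.mp (h1.1 (by omega)), sub_eq_zero.mp (h1.2 (by omega))⟩

/-- The powers of `ad P` for `P` with coordinates `(α, β, p, q)`, on elements of the module. -/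
theorem ad_pow_mk (P : TestLie K) (k : ℕ) (p q : K[X]) :
    (LieAlgebra.ad K (TestLie K) P ^ k) (mk 0 0 p q) =
      mk 0 0 (P.cz ^ k • (X ^ k * p))
        (P.cz ^ k • (X ^ k * q) + ((k : K) * P.cy * P.cz ^ (k - 1)) • (X ^ (k - 1) * p)) := by
  induction k with
  | zero => ext1 <;> simp
  | succ k ih =>
    rw [pow_succ', Module.End.mul_apply, ih, LieAlgebra.ad_apply]
    ext1
    · simp
    · simp
    · simp [smul_eq_C_mul]
      ring
    · cases k with
      | zero => simp [smul_eq_C_mul]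
      | succ k =>
        simp [smul_eq_C_mul]
        ring

/-- The derivation `(α, β, p, q) ↦ (α r, 0, p, (1 + r) q - s p)`. -/
noncomputable def deriv (r s : K) : TestLie K →ₗ[K] TestLie K where
  -- `r = s = 0` grades by the module generator `e`. For `r = 1` the element `y` counts as well, and
  -- the correction by `s` makes `y + e + s [y, e]` an eigenvector of eigenvalue one.
  toFun u := mk (r * u.cy) 0 u.c0 ((1 + r) • u.c1 - s • u.c0)
  map_add' u v := by
    ext1 <;> simp [mul_add]
    abel
  map_smul' c u := by
    ext1 <;> simp [smul_eq_C_mul]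
    all_goals ring

theorem deriv_lie (r s : K) (u v : TestLie K) :
    deriv r s ⁅u, v⁆ = ⁅deriv r s u, v⁆ + ⁅u, deriv r s v⁆ := by
  ext1 <;> simp [deriv, smul_eq_C_mul] <;> ring

theorem coeff_sum_withOne (a : ℕ → K) (N m : ℕ) (hm : m < N) :
    (∑ k ∈ Finset.range N, LTree.withOne a k • (X : K[X]) ^ k).coeff m = LTree.withOne a m := by
  rw [finsetSum_coeff, Finset.sum_eq_single_of_mem m (Finset.mem_range.mpr hm)]
  · simp
  · intro k _ hk
    rw [coeff_smul, coeff_X_pow, if_neg hk.symm, smul_zero]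

/-- The product of `e ∈ K[z]`, `e = 1`, with `α y + β z`. -/
theorem starTrunc_one_right [CharZero K] (a : ℕ → K) {N : ℕ} (hN : 2 ≤ N) (α β : K) :
    starTrunc a N (mk 0 0 1 0) (mk α β 0 0) -
      (mk α β 0 0 + ∑ k ∈ Finset.range N, LTree.withOne a k •
        mk 0 0 (β ^ k • X ^ k) (((k : K) * α * β ^ (k - 1)) • X ^ (k - 1))) ∈
      filtration.toFun N := by
  set P := starTrunc a N (mk 0 0 1 0) (mk α β 0 0) with hP
  have hc := starTrunc_cy_cz a hN (mk 0 0 1 0) (mk α β 0 0)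
  rw [← hP, cy_mk, cy_mk, cz_mk, cz_mk, zero_add, zero_add] at hc
  have h := deriv_starTrunc_sub_mem filtration a N (deriv 0 0) (deriv_lie 0 0)
    (x := mk 0 0 1 0) (y := mk α β 0 0) (mem_filtration_one _) (mem_filtration_one _)
    (by ext1 <;> simp [deriv]) (by ext1 <;> simp [deriv])
  rw [← hP] at h
  simp only [ad_pow_mk, hc.1, hc.2, mul_one, mul_zero, smul_zero, zero_add] at h
  -- The derivation fixes the module part, so the differential equation gives `P` itself; its
  -- right-hand side is explicit because `ad P` on the module depends only on `α` and `β`.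
  have hD : deriv 0 0 P = P - mk α β 0 0 := by
    ext1 <;> simp [deriv, hc]
  rwa [hD, sub_sub] at h

/-- The product of `y + e` with `z`, where `e = (1, s)`. -/
theorem starTrunc_add_left [CharZero K] (a : ℕ → K) {N : ℕ} (hN : 2 ≤ N) (s : K) :
    ∃ p q, starTrunc a N (mk 1 0 1 (C s)) (mk 0 1 0 0) = mk 1 1 p q ∧
      mk 1 0 p ((2 : K) • q - s • p) -
        (mk 1 0 1 (C s) + ∑ k ∈ Finset.range (N - 1), a (k + 1) •
          mk 0 0 (X ^ (k + 1)) (s • X ^ (k + 1) + ((k : K) + 1) • X ^ k - X ^ k * p)) ∈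
        filtration.toFun N := by
  set P := starTrunc a N (mk 1 0 1 (C s)) (mk 0 1 0 0) with hP
  have hc := starTrunc_cy_cz a hN (mk 1 0 1 (C s)) (mk 0 1 0 0)
  rw [← hP, cy_mk, cy_mk, cz_mk, cz_mk, zero_add, add_zero] at hc
  refine ⟨P.c0, P.c1, by ext1 <;> simp [hc], ?_⟩
  have h := deriv_starTrunc_sub_mem filtration a N (deriv 1 s) (deriv_lie 1 s)
    (x := mk 1 0 1 (C s)) (y := mk 0 1 0 0) (mem_filtration_one _) (mem_filtration_one _)
    (by ext1 <;> simp [deriv, smul_eq_C_mul]; ring) (by ext1 <;> simp [deriv])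
  rw [← hP] at h
  have hD : deriv 1 s P = mk 1 0 P.c0 ((2 : K) • P.c1 - s • P.c0) := by
    ext1 <;> simp [deriv, hc, one_add_one_eq_two]
  -- The term `- X ^ k * P.c0` stems from the bracket of `P` with `y`. The unknown product reappears
  -- here, which makes the recursion quadratic.
  have had : ∀ k : ℕ, (LieAlgebra.ad K (TestLie K) P ^ (k + 1)) (mk 1 0 1 (C s)) =
      mk 0 0 (X ^ (k + 1)) (s • X ^ (k + 1) + ((k : K) + 1) • X ^ k - X ^ k * P.c0) := by
    intro k
    have h1 : LieAlgebra.ad K (TestLie K) P (mk 1 0 1 (C s)) =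
        mk 0 0 X (X * C s + 1 - P.c0) := by
      ext1 <;> simp [hc]
    rw [pow_succ, Module.End.mul_apply, h1, ad_pow_mk, hc.1, hc.2]
    ext1
    · simp
    · simp
    · simp [pow_succ]
    · cases k with
      | zero => simp [smul_eq_C_mul]
      | succ k => simp [smul_eq_C_mul]; ring
  obtain ⟨M, rfl⟩ : ∃ M, N = M + 1 := ⟨N - 1, by omega⟩
  rw [hD, Finset.sum_range_succ'] at h
  simp only [had, LTree.withOne, Nat.succ_ne_zero, if_false, if_true, pow_zero, one_smul,
    Module.End.one_apply] at h
  rwa [add_comm (Finset.sum _ _)] at h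

end TestLie

/-! ### The recursion forced by associativity and its solutions. -/

open TestLie

/-- For `x = e` and commuting `y, z`, the product `x ∗ (y ∗ z) = e ∗ (y + z)` is explicit, with
module parts `∑ a_k X^k` and `∑ k a_k X^(k-1)`. By associativity these are the parts `p, q` of `(x ∗
y) ∗ z`, which satisfy the relation of `starTrunc_add_left`; its coefficient of `X^m` is the
recursion. -/
theorem riccati_of_starAssociative {K : Type u} [Field K] [CharZero K] {a : ℕ → K}
    (ha : StarAssociative.{u, v} a) (m : ℕ) :
    ((m : K) + 1) * a (m + 1) = 2 * a 1 * LTree.withOne a m -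
      ∑ p ∈ antidiagonal m, a (p.1 + 1) * LTree.withOne a p.2 := by
  -- Modulo step `N` the component `c1` is known only below degree `N - 2`, and degree `m` is
  -- needed.
  set N := m + 3 with hNdef
  have hN : 2 ≤ N := by omega
  set x : TestLie K := mk 0 0 1 0
  set y : TestLie K := mk 1 0 0 0
  set z : TestLie K := mk 0 1 0 0
  have hassoc := starTrunc_assoc_of_starAssociative ha filtration (mem_filtration_one x)
    (mem_filtration_one y) (mem_filtration_one z) (show 0 < N by omega)
  have hyz : starTrunc a N y z = mk 1 1 0 0 := by
    rw [starTrunc_of_lie_eq_zero a hN (by ext1 <;> simp [y, z])]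
    ext1 <;> simp [y, z]
  -- Since `y` acts with square zero, only the terms `k = 0, 1` survive; this is why `s = a 1`
  -- below.
  have hxy : starTrunc a N x y - mk 1 0 1 (C (a 1)) ∈ filtration.toFun N := by
    have h := starTrunc_one_right a hN 1 0
    rw [hNdef, Finset.sum_range_succ', Finset.sum_range_succ', Finset.sum_eq_zero] at h
    · convert h using 2
      ext1 <;> simp [LTree.withOne, smul_eq_C_mul]
    · intro k _
      ext1 <;> simp
  have hideal : ∀ u : TestLie K, ∀ v ∈ (filtration (K := K)).toFun N, ⁅u, v⁆ ∈ filtration.toFun N := by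
    intro u v hv
    have := filtration.lie_mem (filtration.anti zero_le_one (mem_filtration_one u)) hv
    rwa [zero_add] at this
  have h1 := starTrunc_sub_mem _ hideal a N hxy
    (show z - z ∈ _ by rw [sub_self]; exact zero_mem _)
  obtain ⟨p, q, hpq, h2⟩ := starTrunc_add_left a hN (a 1)
  have h3 := starTrunc_one_right a hN 1 1
  rw [hpq] at h1
  rw [hyz] at hassoc
  have h4 := add_mem (sub_mem hassoc h1) h3
  rw [sub_sub_sub_cancel_left, sub_add_sub_cancel] at h4
  obtain ⟨h5, h6⟩ := coeff_eq_of_sub_mem h4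
  have hp : ∀ j, j ≤ m → p.coeff j = LTree.withOne a j := by
    intro j hj
    have := h5 j (by omega)
    rw [c0_mk, c0_add, c0_mk, zero_add, c0_sum] at this
    simp only [c0_smul, c0_mk, one_pow, one_smul] at this
    rw [this, coeff_sum_withOne a N j (by omega)]
  have hq : q.coeff m = ((m : K) + 1) * a (m + 1) := by
    have := h6 m (by omega)
    rw [c1_mk, c1_add, c1_mk, zero_add, c1_sum, Finset.sum_range_succ'] at this
    simp only [c1_smul, c1_mk, one_pow, mul_one, Nat.add_sub_cancel, Nat.cast_zero, zero_smul,
      smul_zero, add_zero] at this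
    rw [this, finsetSum_coeff, Finset.sum_eq_single_of_mem m (Finset.mem_range.mpr (by omega))]
    · simp [LTree.withOne, mul_comm]
    · intro k _ hk
      simp [coeff_X_pow, hk.symm]
  have h7 := (coeff_eq_of_sub_mem h2).2 m (by omega)
  rw [c1_mk, c1_add, c1_mk, c1_sum, coeff_sub, coeff_add, coeff_smul, coeff_smul, hq,
    hp m le_rfl, finsetSum_coeff] at h7
  simp only [c1_smul, c1_mk, coeff_smul, coeff_sub, coeff_add, smul_eq_mul, mul_sub, mul_add,
    Finset.sum_sub_distrib, Finset.sum_add_distrib] at h7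
  have e1 : (C (a 1)).coeff m + ∑ k ∈ Finset.range (N - 1),
      a (k + 1) * (a 1 * (X ^ (k + 1) : K[X]).coeff m) = a 1 * LTree.withOne a m := by
    cases m with
    | zero => simp [LTree.withOne, coeff_X_pow]
    | succ n =>
      rw [coeff_C_of_ne_zero n.succ_ne_zero, zero_add,
        Finset.sum_eq_single_of_mem n (Finset.mem_range.mpr (by omega))]
      · simp [LTree.withOne, mul_comm]
      · intro k _ hk
        rw [coeff_X_pow, if_neg (by omega), mul_zero, mul_zero]
  have e2 : ∑ k ∈ Finset.range (N - 1), a (k + 1) * (((k : K) + 1) * (X ^ k : K[X]).coeff m) =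
      ((m : K) + 1) * a (m + 1) := by
    rw [Finset.sum_eq_single_of_mem m (Finset.mem_range.mpr (by omega))]
    · simp [mul_comm]
    · intro k _ hk
      rw [coeff_X_pow, if_neg hk.symm, mul_zero, mul_zero]
  have e3 : ∑ k ∈ Finset.range (N - 1), a (k + 1) * (X ^ k * p).coeff m =
      ∑ p ∈ antidiagonal m, a (p.1 + 1) * LTree.withOne a p.2 := by
    rw [Finset.Nat.sum_antidiagonal_eq_sum_range_succ (fun i j => a (i + 1) * LTree.withOne a j),
      show N - 1 = m + 1 + 1 by omega, Finset.sum_range_succ, coeff_X_pow_mul',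
      if_neg (by omega), mul_zero, add_zero]
    refine Finset.sum_congr rfl fun k hk => ?_
    have := Finset.mem_range.mp hk
    rw [coeff_X_pow_mul', if_pos (by omega), hp _ (Nat.sub_le _ _)]
  rw [e2, e3] at h7
  linear_combination h7 + e1

theorem bernCoeff_one [CharZero K] : bernCoeff K 1 = -1 / 2 := by
  simp [bernCoeff]

theorem riccati_bernCoeff [CharZero K] (h : K) (m : ℕ) :
    ((m : K) + 1) * (h ^ (m + 1) * bernCoeff K (m + 1)) = -h * (h ^ m * bernCoeff K m) -
      ∑ p ∈ antidiagonal m, h ^ (p.1 + 1) * bernCoeff K (p.1 + 1) * (h ^ p.2 * bernCoeff K p.2) := by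
  have h1 := succ_mul_bernCoeff K m
  rw [Finset.Nat.sum_antidiagonal_succ, bernCoeff_zero] at h1
  have h2 : ∑ p ∈ antidiagonal m, h ^ (p.1 + 1) * bernCoeff K (p.1 + 1) *
      (h ^ p.2 * bernCoeff K p.2) =
      h ^ (m + 1) * ∑ p ∈ antidiagonal m, bernCoeff K (p.1 + 1) * bernCoeff K p.2 := by
    rw [Finset.mul_sum]
    refine Finset.sum_congr rfl fun p hp => ?_
    rw [← mem_antidiagonal.mp hp]
    ring
  rw [h2]
  linear_combination h ^ (m + 1) * h1

/-- For `m = 0` the recursion is void, so `a 1` is free, and `b_1 = -1/2` dictates `h = -2 a_1`. For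
`m > 0` it determines `a (m + 1)` from the earlier terms. -/
theorem eq_of_riccati [CharZero K] {a : ℕ → K} (ha : ∀ m : ℕ, ((m : K) + 1) * a (m + 1) =
    2 * a 1 * LTree.withOne a m - ∑ p ∈ antidiagonal m, a (p.1 + 1) * LTree.withOne a p.2) (n : ℕ) :
    LTree.withOne a n = (-2 * a 1) ^ n * bernCoeff K n := by
  induction n using Nat.strong_induction_on with
  | _ n ih =>
    match n, ih with
    | 0, _ => simp [LTree.withOne, bernCoeff_zero]
    | 1, _ =>
      rw [bernCoeff_one]
      simp only [LTree.withOne, one_ne_zero, if_false]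
      ring
    | m + 2, ih =>
      have h1 := ha (m + 1)
      have h2 := riccati_bernCoeff (-2 * a 1) (m + 1)
      have ih' : ∀ k, k ≤ m + 1 → LTree.withOne a k = (-2 * a 1) ^ k * bernCoeff K k :=
        fun k hk => ih k (by omega)
      -- The split-off summand with second index zero is the unknown `a (m + 2)` again; moved to the
      -- left, it raises the factor to `m + 3`, which is nonzero.
      rw [Finset.Nat.sum_antidiagonal_succ'] at h1 h2
      have h3 : ∑ p ∈ antidiagonal m, a (p.1 + 1) * LTree.withOne a (p.2 + 1) =
          ∑ p ∈ antidiagonal m, (-2 * a 1) ^ (p.1 + 1) * bernCoeff K (p.1 + 1) *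
            ((-2 * a 1) ^ (p.2 + 1) * bernCoeff K (p.2 + 1)) := by
        refine Finset.sum_congr rfl fun p hp => ?_
        have := mem_antidiagonal.mp hp
        rw [← ih' (p.1 + 1) (by omega), ← ih' (p.2 + 1) (by omega)]
        simp [LTree.withOne]
      rw [h3, ih' 0 (by omega), ih' (m + 1) le_rfl] at h1
      simp only [bernCoeff_zero, pow_zero, mul_one] at h1 h2
      have hne : ((m : K) + 1 + 1 + 1) ≠ 0 := by
        exact_mod_cast (Nat.succ_ne_zero (m + 2))
      simp only [LTree.withOne, Nat.add_eq_zero_iff, OfNat.ofNat_ne_zero, and_false, if_false]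
      refine mul_left_cancel₀ hne ?_
      push_cast at h1 h2
      linear_combination h1 - h2

theorem exists_eq_of_starAssociative {K : Type u} [Field K] [CharZero K] {a : ℕ → K}
    (ha : StarAssociative.{u, v} a) : ∃ h : K, ∀ n : ℕ, 0 < n → a n = h ^ n * bernCoeff K n := by
  refine ⟨-2 * a 1, fun n hn => ?_⟩
  rw [← eq_of_riccati (riccati_of_starAssociative ha) n, LTree.withOne, if_neg hn.ne']

end Converse

theorem mainTheorem2 {K : Type u} [Field K] [CharZero K] (a : ℕ → K) :
    (∀ (L : Type (max u v)) [LieRing L] [LieAlgebra K L], LCSComplete K L →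
      ∀ x y : L, LCSHasSum K (starTerm a x y) (starProd a x y)) ∧
    (StarAssociative.{u, v} a ↔ ∃ h : K, ∀ n : ℕ, 0 < n → a n = h ^ n * bernCoeff K n) ∧
    (∀ h : K, h ≠ 0 → (∀ n : ℕ, 0 < n → a n = h ^ n * bernCoeff K n) →
      ∀ (L : Type (max u v)) [LieRing L] [LieAlgebra K L], LCSComplete K L →
        ∀ x y : L, ∃ p : L, IsBCHProduct K (h • x) (h • y) p ∧ starProd a x y = h⁻¹ • p) ∧
    (StarAssociative.{u, v} a → ∀ n : ℕ, 0 < n →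
      (1 + (n : K) * (-1) ^ n) * a n = -∑ i ∈ Finset.Ico 1 n, (-1) ^ i * a i * a (n - i)) := by
  refine ⟨fun L _ _ hL x y => hL.hasSum_starProd a x y,
    ⟨exists_eq_of_starAssociative, fun ⟨h, ha⟩ L _ _ hL x y z =>
      hL.starProd_bernCoeff_assoc ha x y z⟩,
    fun h hh ha L _ _ hL x y =>
      ⟨h • starProd a x y, hL.isBCHProduct_starProd ha x y, (inv_smul_smul₀ hh _).symm⟩,
    fun hass n hn => ?_⟩
  -- The third claim reduces to the recursion for `h^n b_n`.
  obtain ⟨h, ha⟩ := exists_eq_of_starAssociative hass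
  rw [ha n hn, bernCoeff_recursion K h hn]
  refine congrArg _ (Finset.sum_congr rfl fun i hi => ?_)
  rw [Finset.mem_Ico] at hi
  rw [ha i (by omega), ha (n - i) (by omega)]
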